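/- Let $\phi:\mathbb R\to\mathbb R$ be a symmetric (even) Schwartz function and consider the regularized nonlinear Schrödinger equation $$ i u_t + u_{xx} = \mathcal N(u) := \phi * \big(|\phi * u|^2 (\phi * u)\big), \qquad u(0,x)=u_0(x), \qquad x\in\mathbb R,\ u(t,x)\in\mathbb C. $$ For all real $M_0, M_2$ there is a time $T = T(\phi, M_0, M_2) > 0$ such that the following holds for every $u_0\in C^2(\mathbb R;\mathbb C)$ with $\|u_0\|_{L^\infty}\le M_0$ and $\|u_0''\|_{L^\infty}\le M_2$: the initial value problem has a solution $u$ on $[0,T]\times\mathbb R$, and $u$ is bounded and uniformly continuous on $[0,T]\times\mathbb R$. Here "solution" means that $u$ is continuous on $[0,T]\times\mathbb R$, that $u(0,\cdot)=u_0$, that the equation holds on $(0,T)\times\mathbb R$ in the sense of distributions, and that $$ u(t) = e^{it\partial_{xx}}u_0 - i\int_0^t e^{i(t-\tau)\partial_{xx}}\mathcal N(u(\tau))\,d\tau \qquad (0\le t\le T) $$ pointwise, where for $s>0$ $$ (e^{is\partial_{xx}}f)(x) = \lim_{A\to-\infty,\ B\to\infty}\ \frac{1}{(4\pi i s)^{1/2}}\int_A^B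 e^{i(x-y)^2/(4s)} f(y)\,dy, $$ these limits exist for all $x \in \mathbb R$ and $0 < s \le T$ when $f = u_0$ or $f = \mathcal N(u(\tau))$, $0 \le \tau \le T$, and $e^{i0\partial_{xx}}f=f$. -/

import Mathlib

open Complex MeasureTheory Filter Topology Set
open scoped SchwartzMap ContDiff

noncomputable section

namespace RegularizedNLS

/-- The convolution `(φ ∗ f)(x) = ∫ φ(y) f(x - y) dy` of a real Schwartz function with a
complex-valued function on the line. -/
def conv (φ : 𝓢(ℝ, ℝ)) (f : ℝ → ℂ) : ℝ → ℂ :=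
  convolution (φ : ℝ → ℝ) f (ContinuousLinearMap.lsmul ℝ ℝ) volume

/-- The regularized cubic nonlinearity `N(f) = φ ∗ (|φ ∗ f|² (φ ∗ f))`. -/
def nonlinearity (φ : 𝓢(ℝ, ℝ)) (f : ℝ → ℂ) : ℝ → ℂ :=
  conv φ (fun x => ((‖conv φ f x‖ ^ 2 : ℝ) : ℂ) * conv φ f x)

/-- The kernel `(4πit)^{-1/2} exp(i z² / (4t))` of the free Schrödinger group `exp(itΔ)`. -/
def kernel (t z : ℝ) : ℂ :=
  (4 * (Real.pi : ℂ) * I * (t : ℂ)) ^ (-(1 / 2) : ℂ) * exp (I * (z : ℂ) ^ 2 / (4 * (t : ℂ)))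

/-- The kernel of `exp(itΔ)` integrated against `f` over the interval from `p.1` to `p.2`. -/
def truncatedEvolution (t : ℝ) (f : ℝ → ℂ) (x : ℝ) (p : ℝ × ℝ) : ℂ :=
  ∫ y in p.1..p.2, kernel t (x - y) * f y

/-- The free evolution `(exp(itΔ) f)(x)`, as an improper integral over the line (for bounded `f`
the integral does not converge absolutely); at `t = 0` it is the identity.  Convergence of the
improper integral is asserted separately, by `EvolutionConverges`. -/
def freeEvolution (t : ℝ) (f : ℝ → ℂ) (x : ℝ) : ℂ :=
  if t = 0 then f x else limUnder (atBot ×ˢ atTop) (truncatedEvolution t f x)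

/-- The improper integral that defines `(exp(itΔ) f)(x)` converges. -/
def EvolutionConverges (t : ℝ) (f : ℝ → ℂ) (x : ℝ) : Prop :=
  ∃ w : ℂ, Tendsto (truncatedEvolution t f x) (atBot ×ˢ atTop) (𝓝 w)

/-- `u` satisfies `i u_t + u_xx = N(u)` on `(0, T) × ℝ` in the sense of distributions. -/
def SolvesWeakly (φ : 𝓢(ℝ, ℝ)) (T : ℝ) (u : ℝ → ℝ → ℂ) : Prop :=
  ∀ ψ : ℝ × ℝ → ℂ, ContDiff ℝ ∞ ψ → HasCompactSupport ψ →
    tsupport ψ ⊆ Ioo 0 T ×ˢ univ →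
    ∫ p : ℝ × ℝ, u p.1 p.2 *
        (-I * deriv (fun s : ℝ => ψ (s, p.2)) p.1
          + iteratedDeriv 2 (fun y : ℝ => ψ (p.1, y)) p.2)
      = ∫ p : ℝ × ℝ, nonlinearity φ (u p.1) p.2 * ψ p

/-- `u` satisfies the Duhamel formula
`u(t) = exp(itΔ) u₀ - i ∫₀ᵗ exp(i(t-τ)Δ) N(u(τ)) dτ` at every point of `[0, T] × ℝ`, where all
the integrals converge. -/
structure SatisfiesDuhamel (φ : 𝓢(ℝ, ℝ)) (u₀ : ℝ → ℂ) (T : ℝ) (u : ℝ → ℝ → ℂ) : Prop where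
  converges_data : ∀ t ∈ Ioc 0 T, ∀ x : ℝ, EvolutionConverges t u₀ x
  converges_nonlinearity : ∀ τ ∈ Icc 0 T, ∀ s ∈ Ioc 0 T, ∀ x : ℝ,
    EvolutionConverges s (nonlinearity φ (u τ)) x
  integrable : ∀ t ∈ Icc 0 T, ∀ x : ℝ,
    IntervalIntegrable (fun τ => freeEvolution (t - τ) (nonlinearity φ (u τ)) x) volume 0 t
  duhamel : ∀ t ∈ Icc 0 T, ∀ x : ℝ,
    u t x = freeEvolution t u₀ x
      - I * ∫ τ in (0 : ℝ)..t, freeEvolution (t - τ) (nonlinearity φ (u τ)) x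

/-- `u` is a solution on `[0, T]` of the initial value problem
`i u_t + u_xx = N(u)`, `u(0, ·) = u₀`: it is continuous on `[0, T] × ℝ`, takes the initial value,
satisfies the equation in the sense of distributions and satisfies the Duhamel formula. -/
structure IsSolution (φ : 𝓢(ℝ, ℝ)) (u₀ : ℝ → ℂ) (T : ℝ) (u : ℝ → ℝ → ℂ) : Prop where
  continuousOn : ContinuousOn (fun p : ℝ × ℝ => u p.1 p.2) (Icc 0 T ×ˢ univ)
  initial : ∀ x : ℝ, u 0 x = u₀ x
  weak : SolvesWeakly φ T u
  mild : SatisfiesDuhamel φ u₀ T u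

end RegularizedNLS

end

/-! For bounded data the integral defining `exp(it∂ₓₓ) f` does not converge absolutely, and the sup
norm of `f` does not control the result. Two bounded derivatives repair this. Integrating by parts
twice gives `exp(it∂ₓₓ) f = f + Q(t) ∗ f''` with `Q(t, z) = √t P(|z|/√t)` (`correctionKernel`),
where `P` is the second primitive of the unit-time kernel that decays at `+∞`. Two terms of the
Fresnel asymptotics yield `P(w) = O(w⁻²)` (`norm_fresnelPrimitive_le`), so `Q(t)` lies in `L¹`,
uniformly for bounded `t`. Thus the improper integrals converge (`tendsto_truncatedEvolution`) and
the evolution is bounded by the sup norms of `f` and `f''` (`exists_norm_smoothEvolution_le`).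

The nonlinearity supplies these derivatives itself: it has the form `φ ∗ G`, and `(φ ∗ G)'' = φ'' ∗
G`, so both sup norms are controlled by that of `G`. No derivative of `u` is needed, and for small
`T` the Duhamel map is a contraction on a ball of bounded continuous functions
(`exists_mild_solution`). The radius and `T` depend only on `φ`, `M₀`, `M₂`.

Uniform continuity follows from the continuity of `Q` in `L¹` under changes of time and
translations: the resulting modulus depends only on the bounds for the data
(`exists_modulus_smoothEvolution`), so it serves `u₀` and all slices of the source at once.

For the weak equation, let `K` be the free kernel. Then `∂ₜQ = iK`, while the kink of `|z|` at the
origin gives `∂_zz Q = K - δ₀`. Hence `i∂ₜQ + ∂_zz Q = -δ₀` (`integral_correctionKernel_mul_test`),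
which makes `f + Q ∗ f''` a weak free solution; Fubini carries this over to the Duhamel integral
(`integral_duhamel_mul_test`). -/

noncomputable section

namespace RegularizedNLS

/-! ### Fresnel integrals and their asymptotics -/

/-- The free Schrödinger kernel at time one. -/
def unitKernel (w : ℝ) : ℂ :=
  (4 * (Real.pi : ℂ) * I) ^ (-(1 / 2) : ℂ) * exp (I * (w : ℂ) ^ 2 / 4)

/-- The primitive of `unitKernel` that vanishes at the origin (a Fresnel integral). -/
def fresnel (w : ℝ) : ℂ := ∫ y in (0 : ℝ)..w, unitKernel y

/-- The second primitive of `unitKernel` that decays at `+∞`. -/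
def fresnelPrimitive (w : ℝ) : ℂ := w * (fresnel w - 1 / 2) + 2 * I * unitKernel w

lemma continuous_unitKernel : Continuous unitKernel := by
  unfold unitKernel; fun_prop

lemma norm_unitKernel (w : ℝ) : ‖unitKernel w‖ = ‖unitKernel 0‖ := by
  have h : I * (w : ℂ) ^ 2 / 4 = ((w ^ 2 / 4 : ℝ) : ℂ) * I := by push_cast; ring
  simp only [unitKernel, norm_mul]
  rw [h, norm_exp_ofReal_mul_I]
  simp

lemma hasDerivAt_unitKernel (w : ℝ) :
    HasDerivAt unitKernel (I * w / 2 * unitKernel w) w := by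
  have h1 : HasDerivAt (fun x : ℝ => I * (x : ℂ) ^ 2 / 4) (I * w / 2) w := by
    have h0 : HasDerivAt (fun x : ℂ => I * x ^ 2 / 4) (I * w / 2) (w : ℂ) := by
      refine (((hasDerivAt_pow 2 (w : ℂ)).const_mul I).div_const 4).congr_deriv ?_
      push_cast; ring
    exact h0.comp_ofReal
  have := (h1.cexp).const_mul ((4 * (Real.pi : ℂ) * I) ^ (-(1 / 2) : ℂ))
  refine this.congr_deriv ?_
  unfold unitKernel; ring

lemma hasDerivAt_fresnel (w : ℝ) : HasDerivAt fresnel (unitKernel w) w :=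
  intervalIntegral.integral_hasDerivAt_right (continuous_unitKernel.intervalIntegrable _ _)
    (continuous_unitKernel.stronglyMeasurableAtFilter _ _) continuous_unitKernel.continuousAt

/-- The derivative of `2 * I * unitKernel` is `-w * unitKernel w`, which cancels the term produced
by differentiating `fresnel`. -/
lemma hasDerivAt_fresnelPrimitive (w : ℝ) :
    HasDerivAt fresnelPrimitive (fresnel w - 1 / 2) w := by
  have h1 := ((hasDerivAt_id w).ofReal_comp).mul ((hasDerivAt_fresnel w).sub_const (1 / 2))
  have h2 := (hasDerivAt_unitKernel w).const_mul (2 * I)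
  refine (h1.add h2).congr_deriv ?_
  simp only [id, ofReal_one]
  linear_combination ((w : ℂ) * unitKernel w) * I_sq

lemma continuous_fresnelPrimitive : Continuous fresnelPrimitive :=
  continuous_iff_continuousAt.2 fun w => (hasDerivAt_fresnelPrimitive w).continuousAt

/-- The first two terms of the asymptotic expansion of the primitive of `exp (-b y ^ 2)` that
vanishes at `+∞`. -/
def gaussTail (b : ℂ) (y : ℝ) : ℂ :=
  exp (-b * (y : ℂ) ^ 2) * (1 / (4 * b ^ 2 * (y : ℂ) ^ 3) - 1 / (2 * b * y))

lemma hasDerivAt_gaussTail {b : ℂ} (hb : b ≠ 0) {y : ℝ} (hy : y ≠ 0) :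
    HasDerivAt (gaussTail b)
      (exp (-b * (y : ℂ) ^ 2) * (1 - 3 / (4 * b ^ 2 * (y : ℂ) ^ 4))) y := by
  have hy' : (y : ℂ) ≠ 0 := by exact_mod_cast hy
  have hid : HasDerivAt (fun x : ℂ => x) 1 (y : ℂ) := hasDerivAt_id _
  have h1 := ((hid.fun_pow 2).const_mul (-b)).cexp
  have h2 := ((hid.fun_pow 3).const_mul (4 * b ^ 2)).fun_inv (by simp [hb, hy])
  have h3 := (hid.const_mul (2 * b)).fun_inv (by simp [hb, hy])
  have := (h1.fun_mul (h2.fun_sub h3)).comp_ofReal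
  have he : gaussTail b = fun y : ℝ => exp (-b * (y : ℂ) ^ 2) *
      ((4 * b ^ 2 * (y : ℂ) ^ 3)⁻¹ - (2 * b * (y : ℂ))⁻¹) := by
    funext y; simp only [gaussTail, one_div]
  rw [he]
  refine this.congr_deriv ?_
  field_simp
  push_cast
  ring

lemma norm_exp_neg_mul_sq_le {b : ℂ} (hb : 0 ≤ b.re) (y : ℝ) :
    ‖exp (-b * (y : ℂ) ^ 2)‖ ≤ 1 := by
  rw [norm_exp, ← ofReal_pow, neg_mul, neg_re, re_mul_ofReal]
  exact Real.exp_le_one_iff.2 (by nlinarith [mul_nonneg hb (sq_nonneg y)])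

lemma norm_gaussTail_le {b : ℂ} (hb : 0 ≤ b.re) {y : ℝ} (hy : 0 < y) :
    ‖gaussTail b y‖ ≤ 1 / (4 * ‖b‖ ^ 2 * y ^ 3) + 1 / (2 * ‖b‖ * y) := by
  rw [gaussTail, norm_mul]
  calc _ ≤ 1 * ‖1 / (4 * b ^ 2 * (y : ℂ) ^ 3) - 1 / (2 * b * y)‖ := by
        gcongr; exact norm_exp_neg_mul_sq_le hb y
    _ ≤ _ := by
        rw [one_mul]
        refine (norm_sub_le _ _).trans (le_of_eq ?_)
        simp [abs_of_pos hy]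

/-- The derivative of integral minus tail is `exp(-b y²) · 3 / (4 b² y⁴)`. Since `0 ≤ b.re` the
exponential has modulus at most one, and integrating the rest over `[w, ∞)` gives the bound. It does
not degenerate as `b` approaches the imaginary axis. -/
lemma norm_integral_gauss_sub_gaussTail_le {b : ℂ} (hb : 0 ≤ b.re) (hb0 : b ≠ 0) {w W : ℝ}
    (hw : 0 < w) (hW : w ≤ W) :
    ‖((∫ y in (0 : ℝ)..W, exp (-b * (y : ℂ) ^ 2)) - gaussTail b W)
      - ((∫ y in (0 : ℝ)..w, exp (-b * (y : ℂ) ^ 2)) - gaussTail b w)‖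
      ≤ 1 / (4 * ‖b‖ ^ 2 * w ^ 3) := by
  have hbn : 0 < ‖b‖ := norm_pos_iff.2 hb0
  have hcont : Continuous fun y : ℝ => exp (-b * (y : ℂ) ^ 2) := by fun_prop
  set H : ℝ → ℂ := fun x => (∫ y in (0 : ℝ)..x, exp (-b * (y : ℂ) ^ 2)) - gaussTail b x with hH
  have hHd : ∀ x : ℝ, x ≠ 0 →
      HasDerivAt H (exp (-b * (x : ℂ) ^ 2) * (3 / (4 * b ^ 2 * (x : ℂ) ^ 4))) x := by
    intro x hx
    have h1 := intervalIntegral.integral_hasDerivAt_right (hcont.intervalIntegrable 0 x)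
      (hcont.stronglyMeasurableAtFilter _ _) hcont.continuousAt
    refine (h1.sub (hasDerivAt_gaussTail hb0 hx)).congr_deriv ?_
    ring
  have hBd : ∀ x : ℝ, x ≠ 0 → HasDerivAt (fun x : ℝ => 1 / (4 * ‖b‖ ^ 2) * ((w ^ 3)⁻¹ - (x ^ 3)⁻¹))
      (3 / (4 * ‖b‖ ^ 2 * x ^ 4)) x := by
    intro x hx
    have := (((hasDerivAt_pow 3 x).fun_inv (by simpa using hx)).const_sub
      ((w ^ 3)⁻¹)).const_mul (1 / (4 * ‖b‖ ^ 2))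
    refine this.congr_deriv ?_
    field_simp
    norm_num [mul_comm]
  have key := image_norm_le_of_norm_deriv_right_le_deriv_boundary' (a := w) (b := W)
    (f := fun x => H x - H w)
    (f' := fun x => exp (-b * (x : ℂ) ^ 2) * (3 / (4 * b ^ 2 * (x : ℂ) ^ 4)))
    (B := fun x : ℝ => 1 / (4 * ‖b‖ ^ 2) * ((w ^ 3)⁻¹ - (x ^ 3)⁻¹))
    (B' := fun x => 3 / (4 * ‖b‖ ^ 2 * x ^ 4))
    (fun x hx => ((hHd x (by linarith [hx.1])).sub_const _).continuousAt.continuousWithinAt)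
    (fun x hx => ((hHd x (by linarith [hx.1])).sub_const _).hasDerivWithinAt)
    (by simp)
    (fun x hx => (hBd x (by linarith [hx.1])).continuousAt.continuousWithinAt)
    (fun x hx => (hBd x (by linarith [hx.1])).hasDerivWithinAt)
    (by
      intro x hx
      rw [norm_mul]
      calc _ ≤ 1 * ‖(3 : ℂ) / (4 * b ^ 2 * (x : ℂ) ^ 4)‖ := by
            gcongr; exact norm_exp_neg_mul_sq_le hb x
        _ = _ := by
            simp [abs_of_pos (hw.trans_le hx.1)])
    (x := W) ⟨hW, le_rfl⟩
  refine key.trans ?_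
  have hW0 : 0 < W := hw.trans_le hW
  calc _ ≤ 1 / (4 * ‖b‖ ^ 2) * (w ^ 3)⁻¹ := by
        gcongr
        have : 0 < (W ^ 3)⁻¹ := by positivity
        linarith
    _ = _ := by field_simp

lemma tendsto_gaussTail {b : ℂ} (hb : 0 ≤ b.re) :
    Tendsto (gaussTail b) atTop (𝓝 0) := by
  have h : Tendsto (fun y : ℝ => 1 / (4 * ‖b‖ ^ 2 * y ^ 3) + 1 / (2 * ‖b‖ * y)) atTop (𝓝 0) := by
    have h1 : Tendsto (fun y : ℝ => 1 / (4 * ‖b‖ ^ 2) * (y ^ 3)⁻¹ + 1 / (2 * ‖b‖) * y⁻¹)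
        atTop (𝓝 (1 / (4 * ‖b‖ ^ 2) * 0 + 1 / (2 * ‖b‖) * 0)) :=
      ((tendsto_inv_atTop_zero.comp (tendsto_pow_atTop (by norm_num))).const_mul _).add
        (tendsto_inv_atTop_zero.const_mul _)
    simp only [mul_zero, add_zero] at h1
    refine h1.congr fun y => ?_
    simp only [one_div, mul_inv]
  refine squeeze_zero_norm' ?_ h
  filter_upwards [eventually_gt_atTop 0] with y hy using norm_gaussTail_le hb hy

/-- Let `W → ∞` in the previous estimate: for `0 < b.re` the half-line Gaussian integral is known.
-/
lemma norm_gauss_sub_le_of_re_pos {b : ℂ} (hb : 0 < b.re) {w : ℝ} (hw : 0 < w) :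
    ‖((Real.pi / b : ℂ) ^ (1 / 2 : ℂ) / 2)
      - ((∫ y in (0 : ℝ)..w, exp (-b * (y : ℂ) ^ 2)) - gaussTail b w)‖
      ≤ 1 / (4 * ‖b‖ ^ 2 * w ^ 3) := by
  have hb0 : b ≠ 0 := by rintro rfl; simp at hb
  have h1 : Tendsto (fun W : ℝ => ∫ y in (0 : ℝ)..W, exp (-b * (y : ℂ) ^ 2)) atTop
      (𝓝 ((Real.pi / b : ℂ) ^ (1 / 2 : ℂ) / 2)) := by
    rw [← integral_gaussian_complex_Ioi hb]
    exact intervalIntegral_tendsto_integral_Ioi 0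
      (integrable_cexp_neg_mul_sq hb).integrableOn tendsto_id
  have h2 := ((h1.sub (tendsto_gaussTail hb.le)).sub_const
    ((∫ y in (0 : ℝ)..w, exp (-b * (y : ℂ) ^ 2)) - gaussTail b w)).norm
  rw [sub_zero] at h2
  refine le_of_tendsto h2 ?_
  filter_upwards [eventually_ge_atTop w] with W hW
  exact norm_integral_gauss_sub_gaussTail_le hb.le hb0 hw hW

/-- Take `b = -I/4 + ε` and let `ε → 0⁺` with `w` fixed. Only integrals over `[0, w]` have to pass
to the limit, so the value of the conditionally convergent Fresnel integral comes out together with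
the error bound. -/
lemma norm_gauss_sub_le_of_imaginary {w : ℝ} (hw : 0 < w) :
    ‖((4 * Real.pi * I : ℂ) ^ (1 / 2 : ℂ) / 2)
      - ((∫ y in (0 : ℝ)..w, exp (I * (y : ℂ) ^ 2 / 4)) - gaussTail (-I / 4) w)‖
      ≤ 4 / w ^ 3 := by
  set b : ℝ → ℂ := fun ε => -I / 4 + ε with hbdef
  have hbc : Continuous b := by fun_prop
  have hb0 : b 0 = -I / 4 := by simp [hbdef]
  have hbt : Tendsto b (𝓝[>] 0) (𝓝 (-I / 4)) := by
    rw [← hb0]; exact hbc.continuousAt.tendsto.mono_left nhdsWithin_le_nhds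
  have hne : (-I / 4 : ℂ) ≠ 0 := by simp
  have hpi : (Real.pi : ℂ) / (-I / 4) = 4 * Real.pi * I := by
    field_simp
    rw [I_sq]
  have h1 : Tendsto (fun ε => ((Real.pi / b ε : ℂ) ^ (1 / 2 : ℂ) / 2)) (𝓝[>] 0)
      (𝓝 ((4 * Real.pi * I : ℂ) ^ (1 / 2 : ℂ) / 2)) := by
    refine Tendsto.div_const ?_ _
    rw [← hpi]
    refine Tendsto.cpow (tendsto_const_nhds.div hbt hne) tendsto_const_nhds ?_
    rw [hpi]
    -- The limit `4πi` has nonzero imaginary part, so it avoids the branch cut of the square root.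
    right
    simp [Real.pi_ne_zero]
  have h2 : Tendsto (fun ε => ∫ y in (0 : ℝ)..w, exp (-b ε * (y : ℂ) ^ 2)) (𝓝[>] 0)
      (𝓝 (∫ y in (0 : ℝ)..w, exp (I * (y : ℂ) ^ 2 / 4))) := by
    have hc : Continuous fun ε => ∫ y in (0 : ℝ)..w, exp (-b ε * (y : ℂ) ^ 2) :=
      intervalIntegral.continuous_parametric_intervalIntegral_of_continuous' (by fun_prop) _ _
    have := hc.continuousAt.tendsto (x := 0) |>.mono_left (nhdsWithin_le_nhds (s := Ioi 0))
    convert this using 4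
    rw [hb0]; congr 1; ring
  have hwc : (w : ℂ) ≠ 0 := by exact_mod_cast hw.ne'
  have h3 : Tendsto (fun ε => gaussTail (b ε) w) (𝓝[>] 0) (𝓝 (gaussTail (-I / 4) w)) := by
    have : ContinuousAt (fun β : ℂ => gaussTail β w) (-I / 4) := by
      unfold gaussTail
      refine ContinuousAt.mul (by fun_prop) (ContinuousAt.sub ?_ ?_)
      · exact continuousAt_const.div (by fun_prop) (by simp [hw.ne'])
      · exact continuousAt_const.div (by fun_prop) (by simp [hw.ne'])
    exact this.tendsto.comp hbt
  have h4 : Tendsto (fun ε => 1 / (4 * ‖b ε‖ ^ 2 * w ^ 3)) (𝓝[>] 0) (𝓝 (4 / w ^ 3)) := by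
    have : (4 / w ^ 3 : ℝ) = 1 / (4 * ‖(-I / 4 : ℂ)‖ ^ 2 * w ^ 3) := by
      simp; field_simp
    rw [this]
    refine tendsto_const_nhds.div (((hbt.norm.pow 2).const_mul _).mul_const _) ?_
    have : 0 < ‖(-I / 4 : ℂ)‖ := norm_pos_iff.2 hne
    positivity
  refine le_of_tendsto_of_tendsto (h1.sub (h2.sub h3)).norm h4 ?_
  filter_upwards [self_mem_nhdsWithin] with ε hε
  refine norm_gauss_sub_le_of_re_pos ?_ hw
  simpa [hbdef] using hε

lemma norm_fresnel_sub_half_add_le :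
    ∃ C : ℝ, 0 < C ∧ ∀ w : ℝ, 0 < w →
      ‖fresnel w - 1 / 2 + 2 * I * unitKernel w / w‖ ≤ C / w ^ 3 := by
  set c : ℂ := (4 * (Real.pi : ℂ) * I) ^ (-(1 / 2) : ℂ) with hc
  have h4 : (4 * (Real.pi : ℂ) * I) ≠ 0 := by simp [Real.pi_ne_zero]
  have hc0 : c ≠ 0 := by rw [hc]; simp [cpow_eq_zero_iff, Real.pi_ne_zero]
  have hcn : 0 < ‖c‖ := norm_pos_iff.2 hc0
  -- One `4 * ‖c‖` is the error bound at `b = -I/4`; the other is the `w⁻³` term of `gaussTail`.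
  refine ⟨8 * ‖c‖, by positivity, fun w hw => ?_⟩
  have hwc : (w : ℂ) ≠ 0 := by exact_mod_cast hw.ne'
  have hcm : c * (4 * Real.pi * I : ℂ) ^ (1 / 2 : ℂ) = 1 := by
    rw [hc, ← cpow_add _ _ h4]; simp
  have hf : fresnel w = c * ∫ y in (0 : ℝ)..w, exp (I * (y : ℂ) ^ 2 / 4) := by
    rw [← intervalIntegral.integral_const_mul]; rfl
  have hexp : exp (-(-I / 4) * (w : ℂ) ^ 2) = exp (I * (w : ℂ) ^ 2 / 4) := by
    congr 1; ring
  have hk : unitKernel w = c * exp (I * (w : ℂ) ^ 2 / 4) := rfl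
  have hg : c * gaussTail (-I / 4) w = -(4 * unitKernel w / w ^ 3) - 2 * I * unitKernel w / w := by
    rw [gaussTail, hexp, hk]
    field_simp
    simp only [I_sq]
    ring
  have hid : fresnel w - 1 / 2 + 2 * I * unitKernel w / w
      = -(c * (((4 * Real.pi * I : ℂ) ^ (1 / 2 : ℂ) / 2)
      - ((∫ y in (0 : ℝ)..w, exp (I * (y : ℂ) ^ 2 / 4)) - gaussTail (-I / 4) w)))
        - 4 * unitKernel w / w ^ 3 := by
    rw [hf]
    linear_combination (1 / 2) * hcm + hg
  rw [hid]
  refine (norm_sub_le _ _).trans ?_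
  rw [norm_neg, norm_mul]
  have h1 := norm_gauss_sub_le_of_imaginary hw
  have h2 : ‖4 * unitKernel w / (w : ℂ) ^ 3‖ = 4 * ‖c‖ / w ^ 3 := by
    rw [norm_div, norm_mul, norm_unitKernel]
    simp [unitKernel, abs_of_pos hw, hc]
  rw [h2]
  calc _ ≤ ‖c‖ * (4 / w ^ 3) + 4 * ‖c‖ / w ^ 3 := by gcongr
    _ = _ := by ring

/-- For `1 ≤ w` this is `w` times the `O(w⁻³)` remainder of the Fresnel expansion: the summand `2 *
I * unitKernel w` removes the leading term. On `[0, 1]` compactness suffices. -/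
lemma norm_fresnelPrimitive_le :
    ∃ C : ℝ, 0 < C ∧ ∀ w : ℝ, 0 ≤ w → ‖fresnelPrimitive w‖ ≤ C / (1 + w ^ 2) := by
  obtain ⟨C, hC, h⟩ := norm_fresnel_sub_half_add_le
  obtain ⟨D, hD⟩ := (isCompact_Icc (a := (0 : ℝ)) (b := 1)).exists_bound_of_continuousOn
    continuous_fresnelPrimitive.continuousOn
  refine ⟨2 * C + 2 * |D|, by positivity, fun w hw => ?_⟩
  rw [le_div_iff₀ (by positivity)]
  rcases le_total w 1 with h1 | h1
  · have := hD w ⟨hw, h1⟩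
    have h3 : ‖fresnelPrimitive w‖ ≤ |D| := this.trans (le_abs_self D)
    have : w ^ 2 ≤ 1 := by nlinarith
    nlinarith [norm_nonneg (fresnelPrimitive w), abs_nonneg D]
  · have hw0 : 0 < w := by linarith
    have hwc : (w : ℂ) ≠ 0 := by exact_mod_cast hw0.ne'
    have h2 : fresnelPrimitive w = w * (fresnel w - 1 / 2 + 2 * I * unitKernel w / w) := by
      rw [fresnelPrimitive]; field_simp
    have h3 : ‖fresnelPrimitive w‖ ≤ C / w ^ 2 := by
      rw [h2, norm_mul, norm_real, Real.norm_of_nonneg hw]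
      calc _ ≤ w * (C / w ^ 3) := by gcongr; exact h w hw0
        _ = _ := by field_simp
    calc _ ≤ C / w ^ 2 * (1 + w ^ 2) := by gcongr
      _ = C / w ^ 2 + C := by field_simp
      _ ≤ C + C := by gcongr; exact div_le_self hC.le (by nlinarith)
      _ ≤ _ := by linarith [abs_nonneg D]

lemma tendsto_fresnel : Tendsto fresnel atTop (𝓝 (1 / 2)) := by
  obtain ⟨C, hC, h⟩ := norm_fresnel_sub_half_add_le
  have h1 : Tendsto (fun w : ℝ => C * (w ^ 3)⁻¹ + 2 * ‖unitKernel 0‖ * w⁻¹) atTop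
      (𝓝 (C * 0 + 2 * ‖unitKernel 0‖ * 0)) :=
    ((tendsto_inv_atTop_zero.comp (tendsto_pow_atTop (by norm_num))).const_mul _).add
        (tendsto_inv_atTop_zero.const_mul _)
  simp only [mul_zero, add_zero] at h1
  rw [tendsto_iff_norm_sub_tendsto_zero]
  refine squeeze_zero' (.of_forall fun _ => norm_nonneg _) ?_ h1
  filter_upwards [eventually_gt_atTop 0] with w hw
  have h2 : ‖2 * I * unitKernel w / (w : ℂ)‖ = 2 * ‖unitKernel 0‖ * w⁻¹ := by
    rw [norm_div, norm_mul, norm_unitKernel]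
    simp [abs_of_pos hw, div_eq_mul_inv]
  calc _ = ‖(fresnel w - 1 / 2 + 2 * I * unitKernel w / w) - 2 * I * unitKernel w / w‖ := by
        congr 1; ring
    _ ≤ _ := (norm_sub_le _ _).trans (by
        rw [h2]; gcongr; exact (h w hw).trans_eq (div_eq_mul_inv _ _))

/-! ### The correction kernel: decay, continuity, `L¹` modulus -/

/-- The integrable kernel `Q` with `exp(it∂ₓₓ) f = f + Q(t) ∗ f''`. It vanishes for `t ≤ 0`. -/
def correctionKernel (t z : ℝ) : ℂ := (√t : ℂ) * fresnelPrimitive (|z| / √t)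

lemma correctionKernel_of_nonpos {t : ℝ} (ht : t ≤ 0) (z : ℝ) : correctionKernel t z = 0 := by
  simp [correctionKernel, Real.sqrt_eq_zero_of_nonpos ht]

lemma correctionKernel_neg (t z : ℝ) : correctionKernel t (-z) = correctionKernel t z := by
  simp [correctionKernel]

/-- Rescaling the decay of `fresnelPrimitive` gives `C √t³ / (t + z²)`. The form stated has a fixed
integrable profile in `z`, for dominated convergence, and a factor vanishing as `t → 0`, which gives
continuity at `t ≤ 0`. -/
lemma norm_correctionKernel_le :
    ∃ C : ℝ, 0 < C ∧ ∀ t z : ℝ,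
      ‖correctionKernel t z‖ ≤ C * (√t + √t ^ 3) * (1 + z ^ 2)⁻¹ := by
  obtain ⟨C, hC, h⟩ := norm_fresnelPrimitive_le
  refine ⟨C, hC, fun t z => ?_⟩
  rcases le_or_gt t 0 with ht | ht
  · rw [correctionKernel_of_nonpos ht]
    simp only [norm_zero]
    positivity
  have hs : 0 < √t := Real.sqrt_pos.2 ht
  rw [correctionKernel, norm_mul, norm_real, Real.norm_of_nonneg hs.le]
  calc _ ≤ √t * (C / (1 + (|z| / √t) ^ 2)) := by
        gcongr; exact h _ (by positivity)
    _ = C * (√t ^ 3 / (√t ^ 2 + z ^ 2)) := by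
        rw [div_pow, sq_abs]; field_simp
    _ ≤ C * ((√t + √t ^ 3) * (1 + z ^ 2)⁻¹) := by
        gcongr
        rw [← div_eq_mul_inv, div_le_div_iff₀ (by positivity) (by positivity)]
        have : √t ^ 3 * (1 + z ^ 2) + (√t * z ^ 2 + √t ^ 5)
          = (√t + √t ^ 3) * (√t ^ 2 + z ^ 2) := by ring
        have h2 : 0 ≤ √t * z ^ 2 + √t ^ 5 := by positivity
        linarith
    _ = _ := by ring

lemma norm_correctionKernel_le_of_le (R : ℝ) :
    ∃ A : ℝ, 0 < A ∧ ∀ t ≤ R, ∀ z : ℝ, ‖correctionKernel t z‖ ≤ A * (1 + z ^ 2)⁻¹ := by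
  obtain ⟨C, hC, h⟩ := norm_correctionKernel_le
  refine ⟨C * (√R + √R ^ 3) + 1, by positivity, fun t ht z => (h t z).trans ?_⟩
  gcongr
  have : √t ≤ √R := Real.sqrt_le_sqrt ht
  calc C * (√t + √t ^ 3) ≤ C * (√R + √R ^ 3) := by gcongr
    _ ≤ _ := by linarith

lemma continuous_correctionKernel : Continuous fun p : ℝ × ℝ => correctionKernel p.1 p.2 := by
  rw [continuous_iff_continuousAt]
  rintro ⟨t, z⟩
  rcases le_or_gt t 0 with ht | ht
  · obtain ⟨C, hC, h⟩ := norm_correctionKernel_le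
    have h1 : Tendsto (fun p : ℝ × ℝ => C * (√p.1 + √p.1 ^ 3)) (𝓝 (t, z)) (𝓝 0) := by
      have hc : Continuous fun p : ℝ × ℝ => C * (√p.1 + √p.1 ^ 3) := by fun_prop
      simpa [Real.sqrt_eq_zero_of_nonpos ht] using hc.continuousAt.tendsto (x := (t, z))
    rw [ContinuousAt, correctionKernel_of_nonpos ht]
    refine squeeze_zero_norm (fun p => (h p.1 p.2).trans ?_) h1
    exact mul_le_of_le_one_right (by positivity)
      (inv_le_one_of_one_le₀ (by nlinarith [sq_nonneg p.2]))
  · have hs : √t ≠ 0 := (Real.sqrt_pos.2 ht).ne'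
    have h1 : ContinuousAt (fun p : ℝ × ℝ => |p.2| / √p.1) (t, z) :=
      ContinuousAt.div (by fun_prop) (by fun_prop) hs
    have h2 : ContinuousAt (fun p : ℝ × ℝ => ((√p.1 : ℝ) : ℂ)) (t, z) := by fun_prop
    exact h2.mul (ContinuousAt.comp (f := fun p : ℝ × ℝ => |p.2| / √p.1)
      continuous_fresnelPrimitive.continuousAt h1)

@[fun_prop]
lemma Continuous.correctionKernel {X : Type*} [TopologicalSpace X] {s z : X → ℝ}
    (hs : Continuous s) (hz : Continuous z) :
    Continuous fun a => correctionKernel (s a) (z a) :=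
  continuous_correctionKernel.comp (hs.prodMk hz)

lemma integrable_correctionKernel_mul (t : ℝ) {g : ℝ → ℂ} (hg : Continuous g) {M : ℝ}
    (hM : ∀ x, ‖g x‖ ≤ M) : Integrable fun y => correctionKernel t y * g y := by
  obtain ⟨A, hA, h⟩ := norm_correctionKernel_le_of_le t
  refine ((integrable_inv_one_add_sq.const_mul A).mul_const M).mono'
    (by fun_prop : Continuous _).aestronglyMeasurable (.of_forall fun y => ?_)
  rw [norm_mul]
  have := h t le_rfl y
  gcongr
  exact hM y

lemma integrable_correctionKernel (t : ℝ) : Integrable fun y => correctionKernel t y := by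
  simpa using integrable_correctionKernel_mul t (g := fun _ => 1) continuous_const (M := 1)
    (by simp)

lemma norm_integral_correctionKernel_mul_le {A R : ℝ} (hA : 0 < A)
    (h : ∀ t ≤ R, ∀ z : ℝ, ‖correctionKernel t z‖ ≤ A * (1 + z ^ 2)⁻¹) {t : ℝ} (ht : t ≤ R)
    {g : ℝ → ℂ} {M : ℝ} (hM : ∀ x, ‖g x‖ ≤ M) :
    ‖∫ y, correctionKernel t y * g y‖ ≤ A * Real.pi * M := by
  have := norm_integral_le_of_norm_le (f := fun y => correctionKernel t y * g y)
    ((integrable_inv_one_add_sq.const_mul A).mul_const M) (.of_forall fun y => ?_)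
  · rwa [integral_mul_const, integral_const_mul, integral_univ_inv_one_add_sq] at this
  · rw [norm_mul]
    have := h t ht y
    gcongr
    exact hM y

lemma continuous_integral_correctionKernel_mul {X : Type*} [TopologicalSpace X]
    [FirstCountableTopology X] {s : X → ℝ} (hs : Continuous s) {G : X → ℝ → ℂ}
    (hG : Continuous fun p : X × ℝ => G p.1 p.2) {M : ℝ} (hM : ∀ a y, ‖G a y‖ ≤ M) :
    Continuous fun a => ∫ y, correctionKernel (s a) y * G a y := by
  rw [continuous_iff_continuousAt]
  intro a
  obtain ⟨A, hA, h⟩ := norm_correctionKernel_le_of_le (s a + 1)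
  have hG1 : ∀ b, Continuous (G b) := fun b => hG.comp (by fun_prop : Continuous fun y => (b, y))
  have hG2 : ∀ y, Continuous fun b => G b y :=
    fun y => hG.comp (by fun_prop : Continuous fun b => (b, y))
  refine continuousAt_of_dominated (bound := fun y => A * (1 + y ^ 2)⁻¹ * M)
    (.of_forall fun b => ?_) ?_ ((integrable_inv_one_add_sq.const_mul A).mul_const M)
    (.of_forall fun y => ?_)
  · have := hG1 b
    exact (by fun_prop : Continuous fun y => correctionKernel (s b) y * G b y).aestronglyMeasurable
  · have : ∀ᶠ b in 𝓝 a, s b < s a + 1 :=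
      hs.continuousAt.tendsto.eventually_lt_const (by linarith)
    filter_upwards [this] with b hb
    refine .of_forall fun y => ?_
    rw [norm_mul]
    have := h (s b) hb.le y
    gcongr
    exact hM b y
  · have := hG2 y
    exact (by fun_prop : Continuous fun b => correctionKernel (s b) y * G b y).continuousAt

/-- The `L¹` distance of two correction kernels, one of them translated. -/
def kernelModulus (s s' h : ℝ) : ℝ :=
  ∫ z, ‖correctionKernel s (z + h) - correctionKernel s' z‖

lemma continuous_kernelModulus :
    Continuous fun p : ℝ × ℝ × ℝ => kernelModulus p.1 p.2.1 p.2.2 := by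
  rw [continuous_iff_continuousAt]
  rintro ⟨s, s', h⟩
  obtain ⟨A, hA, hb⟩ := norm_correctionKernel_le_of_le (max s s' + 1)
  -- Chosen so that `1 + z² ≤ B (1 + (z + h')²)` whenever `|h'| ≤ 1 + |h|`; one dominating function
  -- then serves all nearby translations.
  set B : ℝ := 2 * (1 + |h|) ^ 2 + 2 with hB
  have hU : ∀ᶠ p : ℝ × ℝ × ℝ in 𝓝 (s, s', h),
      p.1 < max s s' + 1 ∧ p.2.1 < max s s' + 1 ∧ |p.2.2| < |h| + 1 := by
    have h1 : Continuous fun p : ℝ × ℝ × ℝ => p.1 := by fun_prop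
    have h2 : Continuous fun p : ℝ × ℝ × ℝ => p.2.1 := by fun_prop
    have h3 : Continuous fun p : ℝ × ℝ × ℝ => |p.2.2| := by fun_prop
    filter_upwards [h1.continuousAt.tendsto.eventually_lt_const
        (show (s, s', h).1 < max s s' + 1 by linarith [le_max_left s s']),
      h2.continuousAt.tendsto.eventually_lt_const
        (show (s, s', h).2.1 < max s s' + 1 by linarith [le_max_right s s']),
      h3.continuousAt.tendsto.eventually_lt_const
        (show |(s, s', h).2.2| < |h| + 1 by simp)] with p a b c using ⟨a, b, c⟩
  refine continuousAt_of_dominated (bound := fun z => (A * B + A) * (1 + z ^ 2)⁻¹)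
    (.of_forall fun p => ?_) ?_ (integrable_inv_one_add_sq.const_mul _)
    (.of_forall fun y => ?_)
  · exact (by fun_prop : Continuous _).aestronglyMeasurable
  · filter_upwards [hU] with p ⟨h1, h2, h3⟩
    refine .of_forall fun z => ?_
    rw [norm_norm]
    refine (norm_sub_le _ _).trans ?_
    rw [add_mul]
    refine add_le_add ((hb _ h1.le _).trans ?_) (hb _ h2.le z)
    rw [mul_assoc]
    gcongr
    rw [← div_eq_mul_inv, inv_eq_one_div, div_le_div_iff₀ (by positivity) (by positivity)]
    have h4 : p.2.2 ^ 2 ≤ (1 + |h|) ^ 2 := sq_le_sq' (by linarith [(abs_lt.1 h3).1])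
      (by linarith [(abs_lt.1 h3).2])
    rw [hB]
    nlinarith [sq_nonneg (z + 2 * p.2.2), sq_nonneg (z + p.2.2), sq_nonneg (1 + |h|),
      mul_nonneg (sq_nonneg (1 + |h|)) (sq_nonneg (z + p.2.2))]
  · exact (by fun_prop : Continuous fun p : ℝ × ℝ × ℝ =>
      ‖correctionKernel p.1 (y + p.2.2) - correctionKernel p.2.1 y‖).continuousAt

/-- The modulus is uniformly continuous on a compact set of parameters and vanishes at `(s', s',
0)`. -/
lemma kernelModulus_uniform (T : ℝ) {ε : ℝ} (hε : 0 < ε) :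
    ∃ δ > 0, ∀ s ∈ Icc 0 T, ∀ s' ∈ Icc 0 T, ∀ h : ℝ, |s - s'| < δ → |h| < δ →
      kernelModulus s s' h < ε := by
  have hK : IsCompact (Icc 0 T ×ˢ Icc 0 T ×ˢ Icc (-1 : ℝ) 1) :=
    isCompact_Icc.prod (isCompact_Icc.prod isCompact_Icc)
  have hu := hK.uniformContinuousOn_of_continuous continuous_kernelModulus.continuousOn
  obtain ⟨δ, hδ, hd⟩ := Metric.uniformContinuousOn_iff.1 hu ε hε
  refine ⟨min δ 1, by positivity, fun s hs s' hs' h h1 h2 => ?_⟩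
  have h3 := abs_lt.1 (h2.trans_le (min_le_right _ _))
  have := hd (s, s', h) ⟨hs, hs', h3.1.le, h3.2.le⟩ (s', s', 0) ⟨hs', hs', by simp, by simp⟩ (by
    simp only [Prod.dist_eq, dist_self, Real.dist_eq, sub_zero]
    exact max_lt (h1.trans_le (min_le_left _ _)) (max_lt hδ (h2.trans_le (min_le_left _ _))))
  have h0 : kernelModulus s' s' 0 = 0 := by simp [kernelModulus]
  simp only [h0, Real.dist_eq, sub_zero] at this
  exact (le_abs_self _).trans_lt this

/-- Translating the first integral by `x - x'` gives both integrands the factor `g (x' - y)`. The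
whole difference falls on the kernel, so only the sup norm of `g` enters. -/
lemma norm_integral_correctionKernel_sub_le (s s' x x' : ℝ) {g : ℝ → ℂ} (hg : Continuous g)
    {M : ℝ} (hM : ∀ x, ‖g x‖ ≤ M) :
    ‖(∫ y, correctionKernel s y * g (x - y)) - ∫ y, correctionKernel s' y * g (x' - y)‖
      ≤ M * kernelModulus s s' (x - x') := by
  rw [← integral_add_right_eq_self (fun y => correctionKernel s y * g (x - y)) (x - x')]
  have he : ∀ z, x - (z + (x - x')) = x' - z := fun z => by ring
  simp only [he]
  have i1 : Integrable fun z => correctionKernel s (z + (x - x')) * g (x' - z) := by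
    have := (integrable_correctionKernel_mul s (g := fun y => g (x - y)) (by fun_prop)
      (fun y => hM _)).comp_add_right (x - x')
    simpa only [he] using this
  have i2 := integrable_correctionKernel_mul s' (g := fun y => g (x' - y)) (by fun_prop)
      (fun y => hM _)
  rw [← integral_sub i1 i2, kernelModulus, ← integral_const_mul]
  refine norm_integral_le_of_norm_le ?_ (.of_forall fun z => ?_)
  · exact (((integrable_correctionKernel s).comp_add_right (x - x')).sub
      (integrable_correctionKernel s')).norm.const_mul M
  · rw [← sub_mul, norm_mul, mul_comm]
    gcongr
    exact hM _

/-! ### The free evolution of bounded `C²` data -/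

lemma kernel_eq {t : ℝ} (ht : 0 < t) (z : ℝ) :
    kernel t z = unitKernel (z / √t) / (√t : ℂ) := by
  have hs : 0 < √t := Real.sqrt_pos.2 ht
  have hsc : (√t : ℂ) ≠ 0 := by exact_mod_cast hs.ne'
  have hsq : (√t : ℂ) ^ 2 = t := by exact_mod_cast Real.sq_sqrt ht.le
  have htc : (t : ℂ) ≠ 0 := by exact_mod_cast ht.ne'
  have h1 : (4 * (Real.pi : ℂ) * I * (t : ℂ)) ^ (-(1 / 2) : ℂ)
      = (4 * (Real.pi : ℂ) * I) ^ (-(1 / 2) : ℂ) / (√t : ℂ) := by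
    have h4 : 4 * (Real.pi : ℂ) * I ≠ 0 := by simp [Real.pi_ne_zero]
    have hst : (√t : ℂ) = (t : ℂ) ^ (1 / 2 : ℂ) := by
      rw [Real.sqrt_eq_rpow, ofReal_cpow ht.le]; norm_num
    rw [hst, div_eq_mul_inv (_ ^ _) (_ ^ _), ← cpow_neg, mul_comm _ (t : ℂ),
      cpow_def_of_ne_zero (by simp [ht.ne']),
      cpow_def_of_ne_zero h4, cpow_def_of_ne_zero htc, log_ofReal_mul ht h4, ← exp_add,
      ofReal_log ht.le]
    ring_nf
  rw [kernel, h1, unitKernel]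
  have h2 : I * (z : ℂ) ^ 2 / (4 * (t : ℂ)) = I * ((z / √t : ℝ) : ℂ) ^ 2 / 4 := by
    push_cast
    rw [div_pow, hsq]; field_simp
  rw [h2]; ring

/-- `f` is `C²` with derivatives `f'` and `f''`, and `f` and `f''` are bounded by `M₀` and `M₂`. -/
structure IsBoundedC2 (f f' f'' : ℝ → ℂ) (M₀ M₂ : ℝ) : Prop where
  hasDerivAt : ∀ x, HasDerivAt f (f' x) x
  hasDerivAt' : ∀ x, HasDerivAt f' (f'' x) x
  continuous'' : Continuous f''
  bound : ∀ x, ‖f x‖ ≤ M₀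
  bound'' : ∀ x, ‖f'' x‖ ≤ M₂

namespace IsBoundedC2

variable {f f' f'' : ℝ → ℂ} {M₀ M₂ : ℝ}

lemma continuous (h : IsBoundedC2 f f' f'' M₀ M₂) : Continuous f :=
  continuous_iff_continuousAt.2 fun x => (h.hasDerivAt x).continuousAt

lemma continuous' (h : IsBoundedC2 f f' f'' M₀ M₂) : Continuous f' :=
  continuous_iff_continuousAt.2 fun x => (h.hasDerivAt' x).continuousAt

lemma comp_add_left (h : IsBoundedC2 f f' f'' M₀ M₂) (a : ℝ) :
    IsBoundedC2 (fun x => f (a + x)) (fun x => f' (a + x)) (fun x => f'' (a + x)) M₀ M₂ where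
  hasDerivAt x := (h.hasDerivAt (a + x)).comp_const_add a x
  hasDerivAt' x := (h.hasDerivAt' (a + x)).comp_const_add a x
  continuous'' := h.continuous''.comp (by fun_prop)
  bound x := h.bound _
  bound'' x := h.bound'' _

lemma comp_neg (h : IsBoundedC2 f f' f'' M₀ M₂) :
    IsBoundedC2 (fun x => f (-x)) (fun x => -f' (-x)) (fun x => f'' (-x)) M₀ M₂ where
  hasDerivAt x := 
    (HasDerivAt.scomp x (h.hasDerivAt (-x)) (hasDerivAt_neg x)).congr_deriv (by simp)
  hasDerivAt' x := 
    (HasDerivAt.scomp x (h.hasDerivAt' (-x)) (hasDerivAt_neg x)).neg.congr_deriv (by simp)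
  continuous'' := h.continuous''.comp (by fun_prop)
  bound x := h.bound _
  bound'' x := h.bound'' _

/-- Landau's interpolation inequality on an interval of length one: `f' x` differs from `f (x + 1) -
f x` by at most `M₂`. -/
lemma norm_deriv_le (h : IsBoundedC2 f f' f'' M₀ M₂) (x : ℝ) : ‖f' x‖ ≤ 2 * M₀ + M₂ := by
  have hM : 0 ≤ M₂ := (norm_nonneg _).trans (h.bound'' 0)
  have hlip : ∀ y z, ‖f' y - f' z‖ ≤ M₂ * ‖y - z‖ := fun y z =>
    convex_univ.norm_image_sub_le_of_norm_hasDerivWithin_le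
      (fun w _ => (h.hasDerivAt' w).hasDerivWithinAt) (fun w _ => h.bound'' w) (mem_univ z)
      (mem_univ y)
  have hg : ∀ y ∈ Icc x (x + 1),
      HasDerivWithinAt (fun y : ℝ => f y - y * f' x) (f' y - f' x) (Icc x (x + 1)) y := by
    intro y _
    have := (h.hasDerivAt y).sub (((hasDerivAt_id y).ofReal_comp).mul_const (f' x))
    exact (this.congr_deriv (by simp)).hasDerivWithinAt
  have := (convex_Icc x (x + 1)).norm_image_sub_le_of_norm_hasDerivWithin_le hg (C := M₂)
    (fun y hy => (hlip y x).trans (mul_le_of_le_one_right hM (by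
      rw [Real.norm_eq_abs, abs_of_nonneg (by linarith [hy.1])]; linarith [hy.2])))
    (x := x) (y := x + 1) (by simp) (by simp)
  have he : f' x = (f (x + 1) - f x)
      - ((f (x + 1) - ((x + 1 : ℝ) : ℂ) * f' x) - (f x - (x : ℂ) * f' x)) := by
    push_cast; ring
  rw [he]
  refine (norm_sub_le _ _).trans ?_
  have h1 := norm_sub_le (f (x + 1)) (f x)
  simp only [add_sub_cancel_left, norm_one, mul_one] at this
  linarith [h.bound x, h.bound (x + 1)]

end IsBoundedC2

/-- The free evolution of `f` at time `t`, written with the second derivative `f''`. -/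
def smoothEvolution (f f'' : ℝ → ℂ) (t x : ℝ) : ℂ :=
  f x + ∫ y, correctionKernel t y * f'' (x - y)

lemma hasDerivAt_fresnel_div {s : ℝ} (z : ℝ) :
    HasDerivAt (fun z : ℝ => fresnel (z / s) - 1 / 2) (unitKernel (z / s) / s) z := by
  have := (HasDerivAt.scomp z (hasDerivAt_fresnel (z / s)) 
    ((hasDerivAt_id z).div_const s)).sub_const (1 / 2)
  refine this.congr_deriv ?_
  rw [real_smul]; push_cast; ring

lemma hasDerivAt_fresnelPrimitive_div {s : ℝ} (hs : s ≠ 0) (z : ℝ) :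
    HasDerivAt (fun z : ℝ => (s : ℂ) * fresnelPrimitive (z / s)) (fresnel (z / s) - 1 / 2) z := by
  have := (HasDerivAt.scomp z (hasDerivAt_fresnelPrimitive (z / s))
    ((hasDerivAt_id z).div_const s)).const_mul (s : ℂ)
  have hs' : (s : ℂ) ≠ 0 := by exact_mod_cast hs
  refine this.congr_deriv ?_
  rw [real_smul]; push_cast; field_simp

/-- Integration by parts, twice, against the kernel on a half line. -/
lemma tendsto_integral_kernel_mul {f f' f'' : ℝ → ℂ} {M₀ M₂ : ℝ}
    (h : IsBoundedC2 f f' f'' M₀ M₂) {t : ℝ} (ht : 0 < t) :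
    Tendsto (fun b : ℝ => ∫ z in (0 : ℝ)..b, kernel t z * f z) atTop
      (𝓝 (f 0 / 2 + correctionKernel t 0 * f' 0
        + ∫ z in Ioi (0 : ℝ), correctionKernel t z * f'' z)) := by
  have hs : 0 < √t := Real.sqrt_pos.2 ht
  set s := √t with hs_def
  -- `q` agrees with `correctionKernel t` for `0 ≤ z`, but without the absolute value it is
  -- differentiable at the origin as well.
  set q : ℝ → ℂ := fun z => (s : ℂ) * fresnelPrimitive (z / s) with hq
  set H : ℝ → ℂ := fun z => (fresnel (z / s) - 1 / 2) * f z - q z * f' z with hH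
  have hqc : Continuous q := by
    have := continuous_fresnelPrimitive
    fun_prop
  have hkc : Continuous (kernel t) := by
    have h1 : kernel t = fun z => unitKernel (z / s) / (s : ℂ) := funext fun z => kernel_eq ht z
    rw [h1]
    have := continuous_unitKernel
    fun_prop
  have hd : ∀ z, HasDerivAt H (kernel t z * f z - q z * f'' z) z := by
    intro z
    have := ((hasDerivAt_fresnel_div (s := s) z).mul (h.hasDerivAt z)).sub
      ((hasDerivAt_fresnelPrimitive_div hs.ne' z).mul (h.hasDerivAt' z))
    refine this.congr_deriv ?_
    rw [kernel_eq ht]; ring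
  have c0 := h.continuous
  have c2 := h.continuous''
  have hqQ : ∀ z, 0 ≤ z → q z = correctionKernel t z := by
    intro z hz
    rw [correctionKernel, abs_of_nonneg hz]
  have hint : ∀ b, 0 ≤ b → ∫ z in (0 : ℝ)..b, kernel t z * f z
      = H b - H 0 + ∫ z in (0 : ℝ)..b, correctionKernel t z * f'' z := by
    intro b hb
    have h1 := intervalIntegral.integral_eq_sub_of_hasDerivAt (a := 0) (b := b)
      (fun z _ => hd z) ((by fun_prop : Continuous _).intervalIntegrable _ _)
    rw [intervalIntegral.integral_sub ((by fun_prop : Continuous _).intervalIntegrable _ _)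
      ((by fun_prop : Continuous _).intervalIntegrable _ _)] at h1
    have h2 : ∫ z in (0 : ℝ)..b, correctionKernel t z * f'' z = ∫ z in (0 : ℝ)..b, q z * f'' z := by
      refine intervalIntegral.integral_congr fun z hz => ?_
      rw [uIcc_of_le hb] at hz
      simp only [hqQ z hz.1]
    rw [h2, ← h1]; ring
  have hM : 0 ≤ M₂ := (norm_nonneg _).trans (h.bound'' 0)
  have hM0 : 0 ≤ M₀ := (norm_nonneg _).trans (h.bound 0)
  have hH0 : H 0 = -(f 0 / 2 + correctionKernel t 0 * f' 0) := by
    rw [← hqQ 0 le_rfl]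
    simp only [hH, zero_div, fresnel, intervalIntegral.integral_same]
    ring
  -- No boundary term survives at infinity: `fresnel` tends to `1 / 2` against bounded `f`, and `q`
  -- decays against `f'`, bounded by `norm_deriv_le`.
  have hHt : Tendsto H atTop (𝓝 0) := by
    have t1 : Tendsto (fun z : ℝ => ‖fresnel (z / s) - 1 / 2‖ * M₀) atTop (𝓝 (0 * M₀)) := by
      refine Tendsto.mul_const _ ?_
      rw [← tendsto_iff_norm_sub_tendsto_zero]
      exact tendsto_fresnel.comp (tendsto_id.atTop_div_const hs)
    obtain ⟨A, hA, hQ⟩ := norm_correctionKernel_le_of_le t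
    have t2 : Tendsto (fun z : ℝ => A * (2 * M₀ + M₂) * (1 + z ^ 2)⁻¹) atTop
        (𝓝 (A * (2 * M₀ + M₂) * 0)) := by
      refine Tendsto.const_mul _ (tendsto_inv_atTop_zero.comp ?_)
      exact tendsto_atTop_add_const_left _ _ (tendsto_pow_atTop two_ne_zero)
    have t3 := t1.add t2
    simp only [zero_mul, mul_zero, add_zero] at t3
    refine squeeze_zero_norm' ?_ t3
    filter_upwards [eventually_ge_atTop 0] with z hz
    refine (norm_sub_le _ _).trans ?_
    rw [norm_mul, norm_mul, hqQ z hz]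
    refine add_le_add (mul_le_mul_of_nonneg_left (h.bound z) (norm_nonneg _)) ?_
    calc _ ≤ A * (1 + z ^ 2)⁻¹ * (2 * M₀ + M₂) :=
          mul_le_mul (hQ t le_rfl z) (h.norm_deriv_le z) (norm_nonneg _) (by positivity)
      _ = _ := by ring
  have hI := intervalIntegral_tendsto_integral_Ioi (0 : ℝ)
    (integrable_correctionKernel_mul t c2 h.bound'').integrableOn tendsto_id
  have := (hHt.sub_const (H 0)).add hI
  rw [hH0] at this
  simp only [zero_sub, neg_neg, id] at this
  refine this.congr' ?_
  filter_upwards [eventually_ge_atTop 0] with b hb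
  rw [hint b hb, hH0]

lemma continuous_kernel (t : ℝ) : Continuous (kernel t) := by
  unfold kernel; fun_prop

lemma kernel_neg (t z : ℝ) : kernel t (-z) = kernel t z := by
  simp [kernel]

/-- Split at `y = x` and use the half-line formula on each side. The two halves of `f x` add up, and
the boundary terms with `f' x` cancel because the reflection changes the sign of the derivative. -/
lemma tendsto_truncatedEvolution {f f' f'' : ℝ → ℂ} {M₀ M₂ : ℝ}
    (h : IsBoundedC2 f f' f'' M₀ M₂) {t : ℝ} (ht : 0 < t) (x : ℝ) :
    Tendsto (truncatedEvolution t f x) (atBot ×ˢ atTop) (𝓝 (smoothEvolution f f'' t x)) := by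
  have tr : Tendsto (fun p : ℝ × ℝ => ∫ z in (0 : ℝ)..(p.2 - x), kernel t z * f (x + z))
      (atBot ×ˢ atTop) (𝓝 (f x / 2 + correctionKernel t 0 * f' x
          + ∫ z in Ioi (0 : ℝ), correctionKernel t z * f'' (x + z))) := by
    have h1 := tendsto_integral_kernel_mul (h.comp_add_left x) ht
    simp only [add_zero] at h1
    have h2 : Tendsto (fun p : ℝ × ℝ => p.2 - x) (atBot ×ˢ atTop) atTop :=
      tendsto_atTop_add_const_right _ (-x) tendsto_snd
    exact h1.comp h2
  have tl : Tendsto (fun p : ℝ × ℝ => ∫ z in (0 : ℝ)..(x - p.1), kernel t z * f (x - z))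
      (atBot ×ˢ atTop) (𝓝 (f x / 2 - correctionKernel t 0 * f' x
          + ∫ z in Ioi (0 : ℝ), correctionKernel t z * f'' (x - z))) := by
    have h1 := tendsto_integral_kernel_mul (h.comp_add_left x).comp_neg ht
    simp only [neg_zero, add_zero, mul_neg, ← sub_eq_add_neg] at h1
    have h2 : Tendsto (fun p : ℝ × ℝ => x - p.1) (atBot ×ˢ atTop) atTop :=
      tendsto_atTop_add_const_left _ x (tendsto_neg_atBot_atTop.comp tendsto_fst)
    exact h1.comp h2
  have hc : Continuous fun y => kernel t (x - y) * f y := by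
    have h1 := h.continuous
    have h2 := continuous_kernel t
    fun_prop
  have hv : smoothEvolution f f'' t x
      = (f x / 2 - correctionKernel t 0 * f' x
          + ∫ z in Ioi (0 : ℝ), correctionKernel t z * f'' (x - z))
        + (f x / 2 + correctionKernel t 0 * f' x
          + ∫ z in Ioi (0 : ℝ), correctionKernel t z * f'' (x + z)) := by
    have hi : Integrable fun y => correctionKernel t y * f'' (x - y) :=
      integrable_correctionKernel_mul t (h.continuous''.comp (by fun_prop)) (fun y => h.bound'' _)
    rw [smoothEvolution, ← intervalIntegral.integral_Iic_add_Ioi hi.integrableOn hi.integrableOn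
      (b := 0)]
    have e1 : ∫ y in Iic (0 : ℝ), correctionKernel t y * f'' (x - y)
        = ∫ z in Ioi (0 : ℝ), correctionKernel t z * f'' (x + z) := by
      have := integral_comp_neg_Ioi (0 : ℝ) fun y => correctionKernel t y * f'' (x - y)
      simpa only [correctionKernel_neg, sub_neg_eq_add, neg_zero] using this.symm
    rw [e1]
    ring
  rw [hv]
  refine (tl.add tr).congr fun p => ?_
  rw [truncatedEvolution, ← intervalIntegral.integral_add_adjacent_intervals
    (hc.intervalIntegrable p.1 x) (hc.intervalIntegrable x p.2)]
  congr 1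
  · have := intervalIntegral.integral_comp_sub_left (a := 0) (b := x - p.1)
      (fun y => kernel t (x - y) * f y) x
    simpa only [sub_sub_cancel, sub_zero] using this
  · have := intervalIntegral.integral_comp_add_left (a := 0) (b := p.2 - x)
      (fun y => kernel t (x - y) * f y) x
    simpa only [add_zero, add_sub_cancel, sub_add_cancel_left, kernel_neg] using this

lemma evolutionConverges {f f' f'' : ℝ → ℂ} {M₀ M₂ : ℝ}
    (h : IsBoundedC2 f f' f'' M₀ M₂) {t : ℝ} (ht : 0 < t) (x : ℝ) : EvolutionConverges t f x :=
  ⟨_, tendsto_truncatedEvolution h ht x⟩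

lemma smoothEvolution_zero (f f'' : ℝ → ℂ) (x : ℝ) : smoothEvolution f f'' 0 x = f x := by
  simp [smoothEvolution, correctionKernel_of_nonpos le_rfl]

lemma freeEvolution_eq {f f' f'' : ℝ → ℂ} {M₀ M₂ : ℝ}
    (h : IsBoundedC2 f f' f'' M₀ M₂) {t : ℝ} (ht : 0 ≤ t) (x : ℝ) :
    freeEvolution t f x = smoothEvolution f f'' t x := by
  rcases ht.eq_or_lt with rfl | ht
  · simp [freeEvolution, smoothEvolution_zero]
  · rw [freeEvolution, if_neg ht.ne']
    exact (tendsto_truncatedEvolution h ht x).limUnder_eq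

/-! ### Test functions and the weak free equation -/

/-- `ψ` is a test function with derivatives `ψt`, `ψx`, `ψxx`, all of which vanish at times `≥ L`
and at distance `≥ R` from the origin. -/
structure TestJet (ψ ψt ψx ψxx : ℝ → ℝ → ℂ) (L R : ℝ) : Prop where
  continuous : Continuous fun p : ℝ × ℝ => ψ p.1 p.2
  continuous_t : Continuous fun p : ℝ × ℝ => ψt p.1 p.2
  continuous_x : Continuous fun p : ℝ × ℝ => ψx p.1 p.2
  continuous_xx : Continuous fun p : ℝ × ℝ => ψxx p.1 p.2
  hasDerivAt_t : ∀ t x, HasDerivAt (fun s => ψ s x) (ψt t x) t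
  hasDerivAt_x : ∀ t x, HasDerivAt (fun y => ψ t y) (ψx t x) x
  hasDerivAt_xx : ∀ t x, HasDerivAt (fun y => ψx t y) (ψxx t x) x
  eq_zero : ∀ t x, L ≤ t ∨ R ≤ |x| → ψ t x = 0 ∧ ψt t x = 0 ∧ ψx t x = 0 ∧ ψxx t x = 0

namespace TestJet

variable {ψ ψt ψx ψxx : ℝ → ℝ → ℂ} {L R : ℝ}

lemma comp_neg (h : TestJet ψ ψt ψx ψxx L R) :
    TestJet (fun t x => ψ t (-x)) (fun t x => ψt t (-x)) (fun t x => -ψx t (-x))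
      (fun t x => ψxx t (-x)) L R where
  continuous := h.continuous.comp (by fun_prop : Continuous fun p : ℝ × ℝ => (p.1, -p.2))
  continuous_t := h.continuous_t.comp (by fun_prop : Continuous fun p : ℝ × ℝ => (p.1, -p.2))
  continuous_x := (h.continuous_x.comp (by fun_prop : Continuous fun p : ℝ × ℝ => (p.1, -p.2))).neg
  continuous_xx := h.continuous_xx.comp (by fun_prop : Continuous fun p : ℝ × ℝ => (p.1, -p.2))
  hasDerivAt_t t x := h.hasDerivAt_t t (-x)
  hasDerivAt_x t x :=
    (HasDerivAt.scomp x (h.hasDerivAt_x t (-x)) (hasDerivAt_neg x)).congr_deriv (by simp)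
  hasDerivAt_xx t x :=
    (HasDerivAt.scomp x (h.hasDerivAt_xx t (-x)) (hasDerivAt_neg x)).neg.congr_deriv (by simp)
  eq_zero t x hx := by
    simpa using h.eq_zero t (-x) (by simpa using hx)

lemma comp_add_right (h : TestJet ψ ψt ψx ψxx L R) (a : ℝ) :
    TestJet (fun t x => ψ t (x + a)) (fun t x => ψt t (x + a)) (fun t x => ψx t (x + a))
      (fun t x => ψxx t (x + a)) L (R + |a|) where
  continuous := h.continuous.comp (by fun_prop : Continuous fun p : ℝ × ℝ => (p.1, p.2 + a))
  continuous_t := h.continuous_t.comp (by fun_prop : Continuous fun p : ℝ × ℝ => (p.1, p.2 + a))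
  continuous_x := h.continuous_x.comp (by fun_prop : Continuous fun p : ℝ × ℝ => (p.1, p.2 + a))
  continuous_xx := h.continuous_xx.comp (by fun_prop : Continuous fun p : ℝ × ℝ => (p.1, p.2 + a))
  hasDerivAt_t t x := h.hasDerivAt_t t (x + a)
  hasDerivAt_x t x := (h.hasDerivAt_x t (x + a)).comp_add_const x a
  hasDerivAt_xx t x := (h.hasDerivAt_xx t (x + a)).comp_add_const x a
  eq_zero t x hx := h.eq_zero t (x + a) (hx.imp_right fun hx => by
    have := abs_sub (x + a) a
    rw [add_sub_cancel_right] at this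
    linarith)

lemma comp_add_time (h : TestJet ψ ψt ψx ψxx L R) (a : ℝ) :
    TestJet (fun t x => ψ (t + a) x) (fun t x => ψt (t + a) x) (fun t x => ψx (t + a) x)
      (fun t x => ψxx (t + a) x) (L - a) R where
  continuous := h.continuous.comp (by fun_prop : Continuous fun p : ℝ × ℝ => (p.1 + a, p.2))
  continuous_t := h.continuous_t.comp (by fun_prop : Continuous fun p : ℝ × ℝ => (p.1 + a, p.2))
  continuous_x := h.continuous_x.comp (by fun_prop : Continuous fun p : ℝ × ℝ => (p.1 + a, p.2))
  continuous_xx := h.continuous_xx.comp (by fun_prop : Continuous fun p : ℝ × ℝ => (p.1 + a, p.2))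
  hasDerivAt_t t x := (h.hasDerivAt_t (t + a) x).comp_add_const t a
  hasDerivAt_x t x := h.hasDerivAt_x (t + a) x
  hasDerivAt_xx t x := h.hasDerivAt_xx (t + a) x
  eq_zero t x hx := h.eq_zero (t + a) x (hx.imp_left fun hx => by linarith)

end TestJet

lemma norm_kernel {t : ℝ} (ht : 0 < t) (z : ℝ) :
    ‖kernel t z‖ = ‖unitKernel 0‖ * t ^ (-(1 / 2) : ℝ) := by
  rw [kernel_eq ht, norm_div, norm_unitKernel, norm_real, Real.norm_of_nonneg (Real.sqrt_nonneg _),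
    Real.rpow_neg ht.le, Real.sqrt_eq_rpow, div_eq_mul_inv]

lemma measurable_kernel : Measurable fun p : ℝ × ℝ => kernel p.1 p.2 := by
  unfold kernel
  fun_prop

/-- With `w = z / √t` and `P = fresnelPrimitive`, the time derivative is `(P w - w P' w) / (2√t)`,
and `P w - w P' w = 2 * I * unitKernel w`. -/
lemma hasDerivAt_correctionKernel_time {t z : ℝ} (ht : 0 < t) (hz : 0 < z) :
    HasDerivAt (fun s => correctionKernel s z) (I * kernel t z) t := by
  have hs : 0 < √t := Real.sqrt_pos.2 ht
  have hsc : (√t : ℂ) ≠ 0 := by exact_mod_cast hs.ne'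
  have h1 := Real.hasDerivAt_sqrt ht.ne'
  have h2 := (hasDerivAt_const t z).fun_div h1 hs.ne'
  have h3 := h1.ofReal_comp.mul (HasDerivAt.scomp t (hasDerivAt_fresnelPrimitive (z / √t)) h2)
  have he : (fun s => correctionKernel s z)
      = fun s : ℝ => ((√s : ℝ) : ℂ) * (fresnelPrimitive ∘ fun x => z / √x) s := by
    funext s; simp [correctionKernel, abs_of_pos hz]
  rw [he]
  refine h3.congr_deriv ?_
  rw [kernel_eq ht, real_smul]
  simp only [Function.comp, fresnelPrimitive]
  push_cast
  field_simp
  ring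

/-- Integration by parts in space, twice, on the half line. -/
lemma integral_correctionKernel_mul_xx {h ht hx hxx : ℝ → ℝ → ℂ} {L R : ℝ}
    (hh : TestJet h ht hx hxx L R) {t : ℝ} (ht0 : 0 < t) (hR : 0 ≤ R) :
    ∫ z in (0 : ℝ)..R, correctionKernel t z * hxx t z
      = (∫ z in (0 : ℝ)..R, kernel t z * h t z)
        - (correctionKernel t 0 * hx t 0 + 1 / 2 * h t 0) := by
  have hs : 0 < √t := Real.sqrt_pos.2 ht0
  set s := √t with hs_def
  set q : ℝ → ℂ := fun z => (s : ℂ) * fresnelPrimitive (z / s) with hq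
  have hqc : Continuous q := by
    have := continuous_fresnelPrimitive
    fun_prop
  have hkc := continuous_kernel t
  have c0 : Continuous (h t) := hh.continuous.comp (by fun_prop : Continuous fun z => (t, z))
  have c2 : Continuous (hxx t) := hh.continuous_xx.comp (by fun_prop : Continuous fun z => (t, z))
  have hd : ∀ z, HasDerivAt (fun z => q z * hx t z - (fresnel (z / s) - 1 / 2) * h t z)
      (q z * hxx t z - kernel t z * h t z) z := by
    intro z
    have := ((hasDerivAt_fresnelPrimitive_div hs.ne' z).mul (hh.hasDerivAt_xx t z)).sub
      ((hasDerivAt_fresnel_div (s := s) z).mul (hh.hasDerivAt_x t z))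
    refine this.congr_deriv ?_
    rw [kernel_eq ht0]; ring
  have h1 := intervalIntegral.integral_eq_sub_of_hasDerivAt (a := 0) (b := R)
    (fun z _ => hd z) ((by fun_prop : Continuous _).intervalIntegrable _ _)
  rw [intervalIntegral.integral_sub ((by fun_prop : Continuous _).intervalIntegrable _ _)
    ((by fun_prop : Continuous _).intervalIntegrable _ _)] at h1
  have h2 : ∫ z in (0 : ℝ)..R, correctionKernel t z * hxx t z
      = ∫ z in (0 : ℝ)..R, q z * hxx t z := by
    refine intervalIntegral.integral_congr fun z hz => ?_
    rw [uIcc_of_le hR] at hz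
    simp only [hq, correctionKernel, abs_of_nonneg hz.1, hs_def]
  obtain ⟨z1, -, z2, -⟩ := hh.eq_zero t R (Or.inr (le_abs_self R))
  have hq0 : q 0 = correctionKernel t 0 := by simp [hq, correctionKernel, hs_def]
  have hf0 : fresnel 0 = 0 := by simp [fresnel]
  rw [z1, z2, zero_div, hf0, hq0] at h1
  rw [h2]
  linear_combination h1

/-- Integration by parts in time. -/
lemma integral_correctionKernel_mul_t {h ht hx hxx : ℝ → ℝ → ℂ} {L R : ℝ}
    (hh : TestJet h ht hx hxx L R) {z : ℝ} (hz : 0 < z) (hL : 0 ≤ L) :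
    ∫ t in (0 : ℝ)..L, correctionKernel t z * ht t z
      = -I * ∫ t in (0 : ℝ)..L, kernel t z * h t z := by
  have c0 : Continuous fun t => h t z :=
    hh.continuous.comp (by fun_prop : Continuous fun t => (t, z))
  have c1 : Continuous fun t => ht t z :=
    hh.continuous_t.comp (by fun_prop : Continuous fun t => (t, z))
  have i1 : IntervalIntegrable (fun t => correctionKernel t z * ht t z) volume 0 L :=
    (by fun_prop : Continuous _).intervalIntegrable _ _
  have i0 : IntervalIntegrable (fun t => kernel t z) volume 0 L := by
    have hr : IntervalIntegrable (fun t : ℝ => ‖unitKernel 0‖ * t ^ (-(1 / 2) : ℝ)) volume 0 L :=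
      (intervalIntegral.intervalIntegrable_rpow' (by norm_num)).const_mul _
    refine hr.mono_fun' ?_ ?_
    · exact (measurable_kernel.comp
        (by fun_prop : Measurable fun t : ℝ => (t, z))).aestronglyMeasurable
    · rw [uIoc_of_le hL]
      exact (ae_restrict_iff' measurableSet_Ioc).2 (.of_forall fun t ht => (norm_kernel ht.1 z).le)
  have i2 : IntervalIntegrable (fun t => kernel t z * h t z) volume 0 L :=
    i0.mul_continuousOn c0.continuousOn
  -- Differentiability is needed only in the open interval: at `t = 0` the kernel has an integrable
  -- `t^(-1/2)` singularity. Both boundary terms vanish, by `correctionKernel` at `0` and by the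
  -- test function at `L`.
  have h1 := intervalIntegral.integral_eq_sub_of_hasDerivAt_of_le hL
    (f := fun t => correctionKernel t z * h t z)
    (f' := fun t => I * (kernel t z * h t z) + correctionKernel t z * ht t z)
    (by fun_prop : Continuous _).continuousOn
    (fun t ht' => ((hasDerivAt_correctionKernel_time ht'.1 hz).mul 
      (hh.hasDerivAt_t t z)).congr_deriv (by ring)) ((i2.const_mul I).add i1)
  rw [intervalIntegral.integral_add (i2.const_mul I) i1, intervalIntegral.integral_const_mul,
    (hh.eq_zero L z (Or.inl le_rfl)).1, correctionKernel_of_nonpos le_rfl] at h1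
  linear_combination h1

lemma integrable_kernel_mul {h : ℝ → ℝ → ℂ} (hh : Continuous fun p : ℝ × ℝ => h p.1 p.2) (L R : ℝ) :
    Integrable (fun p : ℝ × ℝ => kernel p.1 p.2 * h p.1 p.2)
      ((volume.restrict (Ioc 0 L)).prod (volume.restrict (Ioc 0 R))) := by
  have hc : IsCompact (Icc 0 L ×ˢ Icc 0 R) := isCompact_Icc.prod isCompact_Icc
  obtain ⟨M, hM⟩ := hc.exists_bound_of_continuousOn hh.continuousOn
  have hr : IntegrableOn (fun t : ℝ => ‖unitKernel 0‖ * t ^ (-(1 / 2) : ℝ)) (Ioc 0 L) := by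
    rcases le_or_gt L 0 with hL | hL
    · simp [Ioc_eq_empty_of_le hL]
    · exact (intervalIntegrable_iff_integrableOn_Ioc_of_le hL.le).1
        ((intervalIntegral.intervalIntegrable_rpow' (by norm_num)).const_mul _)
  have hb : Integrable (fun p : ℝ × ℝ => (‖unitKernel 0‖ * p.1 ^ (-(1 / 2) : ℝ)) * M)
      ((volume.restrict (Ioc 0 L)).prod (volume.restrict (Ioc 0 R))) :=
    Integrable.mul_prod hr (integrable_const M)
  refine hb.mono' (measurable_kernel.mul hh.measurable).aestronglyMeasurable ?_
  rw [Measure.prod_restrict]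
  refine (ae_restrict_iff' (measurableSet_Ioc.prod measurableSet_Ioc)).2 (.of_forall fun p hp => ?_)
  rw [norm_mul, norm_kernel hp.1.1]
  gcongr
  · exact mul_nonneg (norm_nonneg _) (Real.rpow_nonneg hp.1.1.le _)
  · exact hM p ⟨Ioc_subset_Icc_self hp.1, Ioc_subset_Icc_self hp.2⟩

lemma integrable_prod_Ioc {F : ℝ × ℝ → ℂ} (hF : Continuous F) (L R : ℝ) :
    Integrable F ((volume.restrict (Ioc 0 L)).prod (volume.restrict (Ioc 0 R))) := by
  rw [Measure.prod_restrict]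
  exact (hF.continuousOn.integrableOn_compact (isCompact_Icc.prod isCompact_Icc)).mono_set
    (prod_mono Ioc_subset_Icc_self Ioc_subset_Icc_self)

/-- The time and space integrations by parts each produce the double integral of `kernel * h`, with
opposite signs. Only the boundary terms at `z = 0` remain. -/
lemma integral_half_correctionKernel_mul {h ht hx hxx : ℝ → ℝ → ℂ} {L R : ℝ}
    (hh : TestJet h ht hx hxx L R) (hL : 0 ≤ L) (hR : 0 ≤ R) :
    ∫ t in Ioc 0 L, ∫ z in Ioc 0 R, correctionKernel t z * (-I * ht t z + hxx t z)
      = -∫ t in Ioc 0 L, (correctionKernel t 0 * hx t 0 + 1 / 2 * h t 0) := by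
  have c0 := hh.continuous
  have c1 := hh.continuous_t
  have c2 := hh.continuous_xx
  have c3 : Continuous fun t => h t 0 :=
    c0.comp (by fun_prop : Continuous fun t : ℝ => (t, (0 : ℝ)))
  have c4 : Continuous fun t => hx t 0 :=
    hh.continuous_x.comp (by fun_prop : Continuous fun t : ℝ => (t, (0 : ℝ)))
  have i1 := integrable_prod_Ioc (F := fun p => correctionKernel p.1 p.2 * ht p.1 p.2)
    (by fun_prop) L R
  have i2 := integrable_prod_Ioc (F := fun p => correctionKernel p.1 p.2 * hxx p.1 p.2)
    (by fun_prop) L R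
  have i3 := integrable_kernel_mul c0 L R
  have i4 : Integrable (fun t => correctionKernel t 0 * hx t 0 + 1 / 2 * h t 0)
      (volume.restrict (Ioc 0 L)) :=
    ((by fun_prop : Continuous fun t => correctionKernel t 0 * hx t 0
      + 1 / 2 * h t 0).continuousOn.integrableOn_compact isCompact_Icc).mono_set Ioc_subset_Icc_self
  have e0 : ∫ t in Ioc 0 L, ∫ z in Ioc 0 R, correctionKernel t z * (-I * ht t z + hxx t z)
      = -I * (∫ t in Ioc 0 L, ∫ z in Ioc 0 R, correctionKernel t z * ht t z)
        + ∫ t in Ioc 0 L, ∫ z in Ioc 0 R, correctionKernel t z * hxx t z := by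
    have i5 : Integrable
        (fun p : ℝ × ℝ => correctionKernel p.1 p.2 * (-I * ht p.1 p.2 + hxx p.1 p.2))
        ((volume.restrict (Ioc 0 L)).prod (volume.restrict (Ioc 0 R))) :=
      integrable_prod_Ioc (by fun_prop) L R
    have p1 := integral_prod _ i1
    have p2 := integral_prod _ i2
    have p5 := integral_prod _ i5
    simp only at p1 p2 p5
    rw [← p1, ← p2, ← p5, ← integral_const_mul, ← integral_add (i1.const_mul _) i2]
    refine integral_congr_ae (.of_forall fun p => ?_)
    simp only; ring
  have e1 : ∫ t in Ioc 0 L, ∫ z in Ioc 0 R, correctionKernel t z * ht t z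
      = -I * ∫ t in Ioc 0 L, ∫ z in Ioc 0 R, kernel t z * h t z := by
    rw [integral_integral_swap (f := fun t z => correctionKernel t z * ht t z) i1,
      integral_integral_swap (f := fun t z => kernel t z * h t z) i3, ← integral_const_mul]
    refine setIntegral_congr_fun measurableSet_Ioc fun z hz => ?_
    rw [← intervalIntegral.integral_of_le hL, ← intervalIntegral.integral_of_le hL]
    exact integral_correctionKernel_mul_t hh hz.1 hL
  have e2 : ∫ t in Ioc 0 L, ∫ z in Ioc 0 R, correctionKernel t z * hxx t z
      = (∫ t in Ioc 0 L, ∫ z in Ioc 0 R, kernel t z * h t z)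
        - ∫ t in Ioc 0 L, (correctionKernel t 0 * hx t 0 + 1 / 2 * h t 0) := by
    rw [← integral_sub i3.integral_prod_left i4]
    refine setIntegral_congr_fun measurableSet_Ioc fun t ht' => ?_
    simp only
    rw [← intervalIntegral.integral_of_le hR, ← intervalIntegral.integral_of_le hR]
    exact integral_correctionKernel_mul_xx hh ht'.1 hR
  rw [e0, e1, e2]
  linear_combination (∫ t in Ioc 0 L, ∫ z in Ioc 0 R, kernel t z * h t z) * I_sq

lemma integral_eq_integral_Ioc_add {g : ℝ → ℂ} (hg : Continuous g) {R : ℝ}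
    (h0 : ∀ x, R ≤ |x| → g x = 0) :
    ∫ x, g x = (∫ x in Ioc 0 R, g x) + ∫ x in Ioc 0 R, g (-x) := by
  have hi : Integrable g := hg.integrable_of_hasCompactSupport
    (HasCompactSupport.intro (isCompact_Icc (a := -R) (b := R)) fun x hx => h0 x (by
      by_contra! h
      exact hx ⟨(abs_lt.1 h).1.le, (abs_lt.1 h).2.le⟩))
  have hIoi : ∀ f : ℝ → ℂ, (∀ x, R ≤ |x| → f x = 0) →
      ∫ x in Ioi (0 : ℝ), f x = ∫ x in Ioc 0 R, f x := fun f hf =>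
    setIntegral_eq_of_subset_of_forall_sdiff_eq_zero measurableSet_Ioi Ioc_subset_Ioi_self
      fun x hx => hf x (by
        by_contra! h
        exact hx.2 ⟨hx.1, (abs_lt.1 h).2.le⟩)
  rw [← intervalIntegral.integral_Iic_add_Ioi hi.integrableOn hi.integrableOn (b := 0),
    ← hIoi g h0, ← hIoi (fun x => g (-x)) (fun x hx => h0 _ (by rwa [abs_neg])),
    integral_comp_neg_Ioi, neg_zero, add_comm]

/-- The correction kernel is a distributional solution of `i ∂ₜ Q + ∂ₓₓ Q = -δ₀(x)` with zero
initial values. -/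
lemma integral_correctionKernel_mul_test {h ht hx hxx : ℝ → ℝ → ℂ} {L R : ℝ}
    (hh : TestJet h ht hx hxx L R) (hL : 0 ≤ L) (hR : 0 ≤ R) :
    ∫ t in Ioc 0 L, ∫ z, correctionKernel t z * (-I * ht t z + hxx t z)
      = -∫ t in Ioc 0 L, h t 0 := by
  have c0 := hh.continuous
  have c1 := hh.continuous_t
  have c2 := hh.continuous_xx
  have c3 : Continuous fun t => h t 0 :=
    c0.comp (by fun_prop : Continuous fun t : ℝ => (t, (0 : ℝ)))
  have c4 : Continuous fun t => hx t 0 :=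
    hh.continuous_x.comp (by fun_prop : Continuous fun t : ℝ => (t, (0 : ℝ)))
  have c5 : Continuous fun p : ℝ × ℝ => ht p.1 (-p.2) := hh.comp_neg.continuous_t
  have c6 : Continuous fun p : ℝ × ℝ => hxx p.1 (-p.2) := hh.comp_neg.continuous_xx
  have hs : ∀ t, ∫ z, correctionKernel t z * (-I * ht t z + hxx t z)
      = (∫ z in Ioc 0 R, correctionKernel t z * (-I * ht t z + hxx t z))
        + ∫ z in Ioc 0 R, correctionKernel t z * (-I * ht t (-z) + hxx t (-z)) := by
    intro t
    have c1' : Continuous (ht t) := c1.comp (by fun_prop : Continuous fun z => (t, z))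
    have c2' : Continuous (hxx t) := c2.comp (by fun_prop : Continuous fun z => (t, z))
    rw [integral_eq_integral_Ioc_add (by fun_prop) (R := R)]
    · simp only [correctionKernel_neg]
    · intro x hx
      obtain ⟨-, h1, -, h2⟩ := hh.eq_zero t x (Or.inr hx)
      rw [h1, h2]; simp
  have j1 := (integrable_prod_Ioc (F := fun p => correctionKernel p.1 p.2
    * (-I * ht p.1 p.2 + hxx p.1 p.2)) (by fun_prop) L R).integral_prod_left
  have j2 := (integrable_prod_Ioc (F := fun p => correctionKernel p.1 p.2
    * (-I * ht p.1 (-p.2) + hxx p.1 (-p.2))) (by fun_prop) L R).integral_prod_left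
  simp only [hs]
  -- Adding the formula for the reflected test function cancels the `hx t 0` terms and joins the two
  -- halves of `h t 0`.
  rw [integral_add j1 j2, integral_half_correctionKernel_mul hh hL hR,
    integral_half_correctionKernel_mul hh.comp_neg hL hR, ← neg_add]
  congr 1
  have iOn : ∀ f : ℝ → ℂ, Continuous f → IntegrableOn f (Ioc 0 L) := fun f hf =>
    (hf.continuousOn.integrableOn_compact isCompact_Icc).mono_set Ioc_subset_Icc_self
  rw [← integral_add (iOn _ (by fun_prop)) (iOn _ (by simp only [neg_zero]; fun_prop))]
  refine integral_congr_ae (.of_forall fun t => ?_)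
  simp only [neg_zero]; ring

lemma integrable_of_eq_zero {g : ℝ → ℂ} (hg : Continuous g) {R : ℝ}
    (h0 : ∀ x, R ≤ |x| → g x = 0) : Integrable g :=
  hg.integrable_of_hasCompactSupport
    (HasCompactSupport.intro (isCompact_Icc (a := -R) (b := R)) fun x hx => h0 x (by
      by_contra! h
      exact hx ⟨(abs_lt.1 h).1.le, (abs_lt.1 h).2.le⟩))

lemma integrable_strip {F : ℝ × ℝ → ℂ} (hF : Continuous F) {R : ℝ}
    (h0 : ∀ t x, R ≤ |x| → F (t, x) = 0) (L : ℝ) :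
    Integrable F ((volume.restrict (Ioc 0 L)).prod volume) := by
  have h1 : IntegrableOn F (Icc 0 L ×ˢ Icc (-R) R) :=
    hF.continuousOn.integrableOn_compact (isCompact_Icc.prod isCompact_Icc)
  have h2 : IntegrableOn F (Icc 0 L ×ˢ univ) := by
    refine h1.of_forall_sdiff_eq_zero (measurableSet_Icc.prod MeasurableSet.univ) ?_
    rintro ⟨t, x⟩ ⟨⟨ht, -⟩, hx⟩
    refine h0 t x ?_
    by_contra! h
    exact hx ⟨ht, (abs_lt.1 h).1.le, (abs_lt.1 h).2.le⟩
  have h3 : (volume.restrict (Ioc 0 L)).prod (volume : Measure ℝ)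
      = ((volume : Measure ℝ).prod volume).restrict (Ioc 0 L ×ˢ univ) := by
    rw [← Measure.prod_restrict, Measure.restrict_univ]
  rw [h3]
  exact h2.mono_set (prod_mono Ioc_subset_Icc_self le_rfl)

lemma IsBoundedC2.integral_mul_xx {f f' f'' : ℝ → ℂ} {M₀ M₂ : ℝ} (hf : IsBoundedC2 f f' f'' M₀ M₂)
    {h ht hx hxx : ℝ → ℝ → ℂ} {L R : ℝ} (hh : TestJet h ht hx hxx L R) (t : ℝ) :
    ∫ x, f x * hxx t x = ∫ x, f'' x * h t x := by
  have c0 : Continuous (h t) := hh.continuous.comp (by fun_prop : Continuous fun z => (t, z))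
  have c1 : Continuous (hx t) := hh.continuous_x.comp (by fun_prop : Continuous fun z => (t, z))
  have c2 : Continuous (hxx t) := hh.continuous_xx.comp (by fun_prop : Continuous fun z => (t, z))
  have f0 := hf.continuous
  have f1 := hf.continuous'
  have f2 := hf.continuous''
  have z : ∀ x, R ≤ |x| → h t x = 0 ∧ hx t x = 0 ∧ hxx t x = 0 := fun x hx => by
    obtain ⟨h1, -, h2, h3⟩ := hh.eq_zero t x (Or.inr hx)
    exact ⟨h1, h2, h3⟩
  rw [integral_mul_deriv_eq_deriv_mul_of_integrable (fun x _ => hf.hasDerivAt x)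
      (fun x _ => hh.hasDerivAt_xx t x),
    integral_mul_deriv_eq_deriv_mul_of_integrable (fun x _ => hf.hasDerivAt' x)
      (fun x _ => hh.hasDerivAt_x t x), neg_neg]
  all_goals
    refine integrable_of_eq_zero (by fun_prop) (R := R) fun x hx => ?_
    simp [z x hx]

/-- The free evolution solves the Schrödinger equation weakly, with the right initial values. -/
lemma integral_smoothEvolution_mul_test {f f' f'' : ℝ → ℂ} {M₀ M₂ : ℝ}
    (hf : IsBoundedC2 f f' f'' M₀ M₂) {h ht hx hxx : ℝ → ℝ → ℂ} {L R : ℝ}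
    (hh : TestJet h ht hx hxx L R) (hL : 0 ≤ L) (hR : 0 ≤ R) :
    ∫ t in Ioc 0 L, ∫ x, smoothEvolution f f'' t x * (-I * ht t x + hxx t x)
      = I * ∫ x, f x * h 0 x := by
  set ν := (volume.restrict (Ioc 0 L)).prod (volume : Measure ℝ) with hν
  have c0 := hh.continuous
  have c1 := hh.continuous_t
  have c2 := hh.continuous_xx
  have f0 := hf.continuous
  have f2 := hf.continuous''
  set P : ℝ × ℝ → ℂ := fun p => -I * ht p.1 p.2 + hxx p.1 p.2 with hP
  have cP : Continuous P := by fun_prop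
  have zP : ∀ t x, R ≤ |x| → P (t, x) = 0 := fun t x hx => by
    obtain ⟨-, h1, -, h2⟩ := hh.eq_zero t x (Or.inr hx)
    simp [hP, h1, h2]
  set c : ℝ × ℝ → ℂ := fun p => ∫ y, correctionKernel p.1 y * f'' (p.2 - y) with hc
  have cc : Continuous c := continuous_integral_correctionKernel_mul (s := fun p : ℝ × ℝ => p.1)
    (by fun_prop) (G := fun p y => f'' (p.2 - y)) (by fun_prop) (fun p y => hf.bound'' _)
  have i1 : Integrable (fun p => f p.2 * P p) ν :=
    integrable_strip (R := R) (by fun_prop) (fun t x hx => by simp [zP t x hx]) L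
  have i2 : Integrable (fun p => c p * P p) ν :=
    integrable_strip (R := R) (by fun_prop) (fun t x hx => by simp [zP t x hx]) L
  have i3 : Integrable (fun p => f p.2 * ht p.1 p.2) ν :=
    integrable_strip (R := R) (by fun_prop)
      (fun t x hx => by simp [hh.eq_zero t x (Or.inr hx)]) L
  have i4 : Integrable (fun p => f p.2 * hxx p.1 p.2) ν :=
    integrable_strip (R := R) (by fun_prop)
      (fun t x hx => by simp [hh.eq_zero t x (Or.inr hx)]) L
  have i5 : Integrable (fun p => f'' p.2 * h p.1 p.2) ν :=
    integrable_strip (R := R) (by fun_prop)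
      (fun t x hx => by simp [hh.eq_zero t x (Or.inr hx)]) L
  have e0 : ∫ t in Ioc 0 L, ∫ x, smoothEvolution f f'' t x * (-I * ht t x + hxx t x)
      = (∫ p, f p.2 * P p ∂ν) + ∫ p, c p * P p ∂ν := by
    rw [← integral_add i1 i2]
    refine Eq.trans ?_ (integral_prod _ (i1.add i2)).symm
    simp only [Pi.add_apply, smoothEvolution, ← add_mul, hP, hc]
  have e1 : ∫ p, f p.2 * P p ∂ν
      = -I * (∫ p, f p.2 * ht p.1 p.2 ∂ν) + ∫ p, f p.2 * hxx p.1 p.2 ∂ν := by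
    rw [← integral_const_mul, ← integral_add (i3.const_mul _) i4]
    refine integral_congr_ae (.of_forall fun p => ?_)
    simp only [hP]; ring
  have e2 : ∫ p, f p.2 * ht p.1 p.2 ∂ν = -∫ x, f x * h 0 x := by
    rw [integral_prod_symm _ i3, ← integral_neg]
    refine integral_congr_ae (.of_forall fun x => ?_)
    simp only
    rw [integral_const_mul, ← intervalIntegral.integral_of_le hL,
      intervalIntegral.integral_eq_sub_of_hasDerivAt (fun t _ => hh.hasDerivAt_t t x)
        ((c1.comp (by fun_prop : Continuous fun t => (t, x))).intervalIntegrable _ _),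
      (hh.eq_zero L x (Or.inl le_rfl)).1]
    ring
  have e3 : ∫ p, f p.2 * hxx p.1 p.2 ∂ν = ∫ p, f'' p.2 * h p.1 p.2 ∂ν := by
    rw [integral_prod _ i4, integral_prod _ i5]
    exact integral_congr_ae (.of_forall fun t => hf.integral_mul_xx hh t)
  have e4 : ∫ p, c p * P p ∂ν
      = ∫ y, ∫ p, correctionKernel p.1 (p.2 - y) * f'' y * P p ∂ν := by
    have hi : Integrable (Function.uncurry fun (p : ℝ × ℝ) (y : ℝ) =>
        correctionKernel p.1 (p.2 - y) * f'' y * P p) (ν.prod volume) := by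
      obtain ⟨A, hA, hQ⟩ := norm_correctionKernel_le_of_le L
      have iP : Integrable P ν := integrable_strip cP zP L
      refine (iP.norm.mul_prod
        (integrable_inv_one_add_sq.const_mul (A * (2 + 2 * R ^ 2) * M₂))).mono' ?_ ?_
      · exact (by unfold Function.uncurry; fun_prop : Continuous _).aestronglyMeasurable
      · have hae : ∀ᵐ q ∂(ν.prod (volume : Measure ℝ)), q.1.1 ∈ Ioc 0 L := by
          have h1 : ∀ᵐ t ∂(volume.restrict (Ioc 0 L)), t ∈ Ioc 0 L :=
            ae_restrict_mem measurableSet_Ioc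
          have h2 : ∀ᵐ p ∂ν, p.1 ∈ Ioc 0 L :=
            (Measure.quasiMeasurePreserving_fst (μ := volume.restrict (Ioc 0 L))
              (ν := volume)).ae h1
          exact (Measure.quasiMeasurePreserving_fst (μ := ν) (ν := volume)).ae h2
        filter_upwards [hae] with q hq
        obtain ⟨⟨t, x⟩, y⟩ := q
        simp only [Function.uncurry]
        rcases le_or_gt R |x| with hx | hx
        · simp [zP t x hx]
        · rw [norm_mul, norm_mul, mul_comm]
          refine mul_le_mul_of_nonneg_left ?_ (norm_nonneg _)
          have h1 := hQ t hq.2 (x - y)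
          -- For `|x| < R` the translated profile is comparable to the centred one, giving an
          -- integrable product bound for Fubini.
          have h2 : (1 + (x - y) ^ 2)⁻¹ ≤ (2 + 2 * R ^ 2) * (1 + y ^ 2)⁻¹ := by
            rw [← div_eq_mul_inv, inv_eq_one_div, div_le_div_iff₀ (by positivity) (by positivity)]
            have : x ^ 2 ≤ R ^ 2 := sq_le_sq' (abs_lt.1 hx).1.le (abs_lt.1 hx).2.le
            nlinarith [sq_nonneg (2 * x - y), sq_nonneg (x - y),
              mul_nonneg (sq_nonneg R) (sq_nonneg (x - y))]
          calc _ ≤ A * ((2 + 2 * R ^ 2) * (1 + y ^ 2)⁻¹) * M₂ := by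
                refine mul_le_mul (h1.trans (mul_le_mul_of_nonneg_left h2 hA.le)) (hf.bound'' y)
                  (norm_nonneg _) (by positivity)
            _ = _ := by ring
    rw [← integral_integral_swap hi]
    refine integral_congr_ae (.of_forall fun p => ?_)
    simp only [hc]
    rw [integral_mul_const, ← integral_sub_left_eq_self _ volume p.2]
    simp only [sub_sub_cancel]
  have e5 : ∀ y, ∫ p, correctionKernel p.1 (p.2 - y) * f'' y * P p ∂ν
      = -∫ t in Ioc 0 L, f'' y * h t y := by
    intro y
    have hi : Integrable (fun p : ℝ × ℝ => correctionKernel p.1 (p.2 - y) * f'' y * P p) ν :=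
      integrable_strip (R := R) (by fun_prop) (fun t x hx => by simp [zP t x hx]) L
    have hk := integral_correctionKernel_mul_test (hh.comp_add_right y) hL (by positivity)
    rw [integral_prod _ hi, integral_const_mul, ← mul_neg]
    simp only [zero_add] at hk
    rw [← hk, ← integral_const_mul]
    refine integral_congr_ae (.of_forall fun t => ?_)
    simp only [hP]
    rw [← integral_const_mul, ← integral_add_right_eq_self _ y]
    refine integral_congr_ae (.of_forall fun x => ?_)
    simp only [add_sub_cancel_right]
    ring
  have e6 : ∫ p, f'' p.2 * h p.1 p.2 ∂ν = ∫ y, ∫ t in Ioc 0 L, f'' y * h t y :=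
    integral_prod_symm _ i5
  -- The integral of `f'' * h` obtained from `f * hxx` cancels the one obtained from `-δ₀`; the
  -- initial term `I * ∫ f * h 0` is left.
  rw [e0, e1, e2, e3, e4]
  simp only [e5]
  rw [integral_neg, ← e6]
  ring

/-- `integral_smoothEvolution_mul_test` with initial time `τ`. -/
lemma integral_smoothEvolution_sub_mul_test {f f' f'' : ℝ → ℂ} {M₀ M₂ : ℝ}
    (hf : IsBoundedC2 f f' f'' M₀ M₂) {h ht hx hxx : ℝ → ℝ → ℂ} {L R : ℝ}
    (hh : TestJet h ht hx hxx L R) {τ : ℝ} (hL : τ ≤ L) (hR : 0 ≤ R) :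
    ∫ t in Ioc τ L, ∫ x, smoothEvolution f f'' (t - τ) x * (-I * ht t x + hxx t x)
      = I * ∫ x, f x * h τ x := by
  have := integral_smoothEvolution_mul_test hf (hh.comp_add_time τ) (sub_nonneg.2 hL) hR
  simp only [zero_add] at this
  rw [← this, ← intervalIntegral.integral_of_le hL,
    ← intervalIntegral.integral_of_le (sub_nonneg.2 hL)]
  have h2 := intervalIntegral.integral_comp_add_right (a := 0) (b := L - τ)
    (fun t => ∫ x, smoothEvolution f f'' (t - τ) x * (-I * ht t x + hxx t x)) τ
  simp only [add_sub_cancel_right, zero_add, sub_add_cancel] at h2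
  exact h2.symm

/-! ### Convolution with a Schwartz function -/

lemma conv_apply (φ : 𝓢(ℝ, ℝ)) (f : ℝ → ℂ) (x : ℝ) :
    conv φ f x = ∫ y, (φ y : ℂ) * f (x - y) := by
  simp [conv, convolution]

lemma integrable_schwartz_mul (φ : 𝓢(ℝ, ℝ)) {f : ℝ → ℂ} (hf : Continuous f) {M : ℝ}
    (hM : ∀ x, ‖f x‖ ≤ M) : Integrable fun y => (φ y : ℂ) * f y := by
  refine ((φ.integrable (μ := volume)).norm.mul_const M).mono'
    (by have := φ.continuous; fun_prop : Continuous _).aestronglyMeasurable (.of_forall fun y => ?_)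
  rw [norm_mul, norm_real]
  gcongr
  exact hM y

/-- The `L¹` norm of a Schwartz function. -/
def schwartzL1 (φ : 𝓢(ℝ, ℝ)) : ℝ := ∫ y, ‖φ y‖

lemma schwartzL1_nonneg (φ : 𝓢(ℝ, ℝ)) : 0 ≤ schwartzL1 φ := integral_nonneg fun _ => norm_nonneg _

lemma norm_conv_le (φ : 𝓢(ℝ, ℝ)) {f : ℝ → ℂ} {M : ℝ} (hM : ∀ x, ‖f x‖ ≤ M) (x : ℝ) :
    ‖conv φ f x‖ ≤ schwartzL1 φ * M := by
  rw [conv_apply, schwartzL1, ← integral_mul_const]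
  refine norm_integral_le_of_norm_le ((φ.integrable (μ := volume)).norm.mul_const M)
    (.of_forall fun y => ?_)
  rw [norm_mul, norm_real]
  gcongr
  exact hM _

lemma continuous_conv (φ : 𝓢(ℝ, ℝ)) {X : Type*} [TopologicalSpace X] [FirstCountableTopology X]
    {G : X → ℝ → ℂ} (hG : Continuous fun p : X × ℝ => G p.1 p.2) {M : ℝ}
    (hM : ∀ a y, ‖G a y‖ ≤ M) : Continuous fun p : X × ℝ => conv φ (G p.1) p.2 := by
  simp only [conv_apply]
  have hφ := φ.continuous
  refine continuous_of_dominated (bound := fun y => ‖φ y‖ * M) (fun p => ?_) (fun p => ?_)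
    ((φ.integrable (μ := volume)).norm.mul_const M) (.of_forall fun y => ?_)
  · have : Continuous fun y => G p.1 (p.2 - y) :=
      hG.comp (by fun_prop : Continuous fun y : ℝ => (p.1, p.2 - y))
    exact (by fun_prop : Continuous _).aestronglyMeasurable
  · refine .of_forall fun y => ?_
    rw [norm_mul, norm_real]
    gcongr
    exact hM _ _
  · have : Continuous fun p : X × ℝ => G p.1 (p.2 - y) :=
      hG.comp (by fun_prop : Continuous fun p : X × ℝ => (p.1, p.2 - y))
    fun_prop

lemma continuous_conv_apply (φ : 𝓢(ℝ, ℝ)) {f : ℝ → ℂ} (hf : Continuous f) {M : ℝ}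
    (hM : ∀ x, ‖f x‖ ≤ M) : Continuous (conv φ f) :=
  (continuous_conv φ (X := Unit) (G := fun _ => f) (by fun_prop) (fun _ => hM)).comp
    (by fun_prop : Continuous fun x : ℝ => ((), x))

lemma conv_sub (φ : 𝓢(ℝ, ℝ)) {f g : ℝ → ℂ} (hf : Continuous f) (hg : Continuous g) {M N : ℝ}
    (hM : ∀ x, ‖f x‖ ≤ M) (hN : ∀ x, ‖g x‖ ≤ N) (x : ℝ) :
    conv φ (fun y => f y - g y) x = conv φ f x - conv φ g x := by
  simp only [conv_apply, mul_sub]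
  exact integral_sub (integrable_schwartz_mul φ (by fun_prop) fun y => hM _)
    (integrable_schwartz_mul φ (by fun_prop) fun y => hN _)

lemma exists_schwartz_decay (φ : 𝓢(ℝ, ℝ)) :
    ∃ C : ℝ, 0 < C ∧ ∀ x, ‖φ x‖ ≤ C * (1 + x ^ 2)⁻¹ := by
  obtain ⟨C0, hC0, h0⟩ := φ.decay 0 0
  obtain ⟨C2, hC2, h2⟩ := φ.decay 2 0
  refine ⟨C0 + C2, by positivity, fun x => ?_⟩
  have h0 := h0 x
  have h2 := h2 x
  simp only [norm_iteratedFDeriv_zero, pow_zero, one_mul, Real.norm_eq_abs, sq_abs] at h0 h2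
  rw [← div_eq_mul_inv, le_div_iff₀ (by positivity), Real.norm_eq_abs]
  linarith

/-- After the substitution `y ↦ x - y` the derivative falls on the Schwartz factor, so `f` need only
be continuous and bounded. Decay of `φ'` dominates the difference quotients locally. -/
lemma hasDerivAt_conv (φ : 𝓢(ℝ, ℝ)) {f : ℝ → ℂ} (hf : Continuous f) {M : ℝ}
    (hM : ∀ x, ‖f x‖ ≤ M) (x : ℝ) :
    HasDerivAt (conv φ f) (conv (SchwartzMap.derivCLM ℝ ℝ φ) f x) x := by
  set φ' := SchwartzMap.derivCLM ℝ ℝ φ with hφ'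
  have hc : ∀ ψ : 𝓢(ℝ, ℝ), conv ψ f = fun x => ∫ y, (ψ (x - y) : ℂ) * f y := by
    intro ψ
    funext x
    rw [conv_apply, ← integral_sub_left_eq_self _ volume x]
    simp only [sub_sub_cancel]
  obtain ⟨C, hC, hd⟩ := exists_schwartz_decay φ'
  have c0 := φ.continuous
  have c1 := φ'.continuous
  have hM0 : 0 ≤ M := (norm_nonneg _).trans (hM 0)
  rw [hc φ, hc φ']
  refine (hasDerivAt_integral_of_dominated_loc_of_deriv_le (s := Ioo (x - 1) (x + 1))
    (bound := fun y => C * (3 * (1 + (x - y) ^ 2)⁻¹) * M)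
    (F := fun x y => (φ (x - y) : ℂ) * f y) (F' := fun x y => (φ' (x - y) : ℂ) * f y)
    (Ioo_mem_nhds (by linarith) (by linarith))
    (.of_forall fun z => (by fun_prop : Continuous _).aestronglyMeasurable) ?_
    (by fun_prop : Continuous _).aestronglyMeasurable
    (.of_forall fun y z hz => ?_) ?_ (.of_forall fun y z hz => ?_)).2
  · have := (integrable_schwartz_mul φ (f := fun y => f (x - y)) (by fun_prop)
      (fun y => hM _)).comp_sub_left x
    simpa only [sub_sub_cancel] using this
  · rw [norm_mul, norm_real]
    have h1 := hd (z - y)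
    have h2 : (1 + (z - y) ^ 2)⁻¹ ≤ 3 * (1 + (x - y) ^ 2)⁻¹ := by
      rw [← div_eq_mul_inv, inv_eq_one_div, div_le_div_iff₀ (by positivity) (by positivity)]
      have : (z - x) ^ 2 ≤ 1 := by
        have := hz.1; have := hz.2
        nlinarith
      nlinarith [sq_nonneg ((z - y) + (z - x))]
    exact mul_le_mul (h1.trans (mul_le_mul_of_nonneg_left h2 hC.le)) (hM y) (norm_nonneg _)
      (by positivity)
  · exact (((integrable_inv_one_add_sq.comp_sub_left x).const_mul 3).const_mul C).mul_const M
  · have h1 : HasDerivAt φ (φ' (z - y)) (z - y) := by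
      rw [hφ', SchwartzMap.derivCLM_apply]
      exact φ.differentiableAt.hasDerivAt
    have h2 : HasDerivAt (fun z => φ (z - y)) (φ' (z - y)) z := h1.comp_sub_const z y
    exact h2.ofReal_comp.mul_const (f y)

/-- The second derivative of a Schwartz function. -/
def schwartzDeriv₂ (φ : 𝓢(ℝ, ℝ)) : 𝓢(ℝ, ℝ) :=
  SchwartzMap.derivCLM ℝ ℝ (SchwartzMap.derivCLM ℝ ℝ φ)

/-- This is what closes the fixed-point argument in the sup norm: the bounds on the convolution and
on its second derivative are both linear in `M`. -/
lemma isBoundedC2_conv (φ : 𝓢(ℝ, ℝ)) {f : ℝ → ℂ} (hf : Continuous f) {M : ℝ}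
    (hM : ∀ x, ‖f x‖ ≤ M) :
    IsBoundedC2 (conv φ f) (conv (SchwartzMap.derivCLM ℝ ℝ φ) f) (conv (schwartzDeriv₂ φ) f)
      (schwartzL1 φ * M) (schwartzL1 (schwartzDeriv₂ φ) * M) where
  hasDerivAt x := hasDerivAt_conv φ hf hM x
  hasDerivAt' x := hasDerivAt_conv _ hf hM x
  continuous'' := continuous_conv_apply _ hf hM
  bound := norm_conv_le φ hM
  bound'' := norm_conv_le _ hM

/-! ### The cubic source and the Duhamel integral -/

/-- The cubic nonlinearity `|w|² w`. -/
def cubic (w : ℂ) : ℂ := ((‖w‖ ^ 2 : ℝ) : ℂ) * w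

lemma continuous_cubic : Continuous cubic := by unfold cubic; fun_prop

lemma cubic_zero : cubic 0 = 0 := by simp [cubic]

lemma norm_cubic_sub_le {w v : ℂ} {r : ℝ} (hw : ‖w‖ ≤ r) (hv : ‖v‖ ≤ r) :
    ‖cubic w - cubic v‖ ≤ 3 * r ^ 2 * ‖w - v‖ := by
  have hr : 0 ≤ r := (norm_nonneg _).trans hw
  have he : cubic w - cubic v
      = ((‖w‖ ^ 2 : ℝ) : ℂ) * (w - v) + ((‖w‖ ^ 2 - ‖v‖ ^ 2 : ℝ) : ℂ) * v := by
    simp only [cubic]; push_cast; ring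
  have h1 : |‖w‖ - ‖v‖| ≤ ‖w - v‖ := abs_norm_sub_norm_le w v
  have h2 : |‖w‖ ^ 2 - ‖v‖ ^ 2| ≤ 2 * r * ‖w - v‖ := by
    have : ‖w‖ ^ 2 - ‖v‖ ^ 2 = (‖w‖ + ‖v‖) * (‖w‖ - ‖v‖) := by ring
    rw [this, abs_mul, abs_of_nonneg (by positivity)]
    gcongr
    linarith
  rw [he]
  refine (norm_add_le _ _).trans ?_
  rw [norm_mul, norm_mul, norm_real, norm_real, Real.norm_eq_abs, Real.norm_eq_abs,
    abs_of_nonneg (by positivity)]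
  calc _ ≤ r ^ 2 * ‖w - v‖ + 2 * r * ‖w - v‖ * r := by gcongr
    _ = _ := by ring

lemma IsBoundedC2.continuous_smoothEvolution {f f' f'' : ℝ → ℂ} {M₀ M₂ : ℝ}
    (hf : IsBoundedC2 f f' f'' M₀ M₂) :
    Continuous fun p : ℝ × ℝ => smoothEvolution f f'' p.1 p.2 := by
  have f0 := hf.continuous
  have f2 := hf.continuous''
  exact (by fun_prop : Continuous fun p : ℝ × ℝ => f p.2).add
    (continuous_integral_correctionKernel_mul (s := fun p : ℝ × ℝ => p.1)
      (by fun_prop) (G := fun p y => f'' (p.2 - y)) (by fun_prop) (fun p y => hf.bound'' _))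

lemma exists_norm_smoothEvolution_le :
    ∃ A : ℝ, 0 < A ∧ ∀ {f f' f'' : ℝ → ℂ} {M₀ M₂ : ℝ}, IsBoundedC2 f f' f'' M₀ M₂ →
      ∀ t ≤ 1, ∀ x, ‖smoothEvolution f f'' t x‖ ≤ M₀ + A * M₂ := by
  obtain ⟨A, hA, h⟩ := norm_correctionKernel_le_of_le 1
  refine ⟨A * Real.pi, by positivity, fun hf t ht x => ?_⟩
  exact (norm_add_le _ _).trans (add_le_add (hf.bound x)
    (norm_integral_correctionKernel_mul_le hA h ht fun y => hf.bound'' (x - y)))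

/-- The free evolution from time `τ` to time `t` of `φ ∗ G(τ)`. -/
def duhamelIntegrand (φ : 𝓢(ℝ, ℝ)) (G : ℝ → ℝ → ℂ) (t τ x : ℝ) : ℂ :=
  smoothEvolution (conv φ (G τ)) (conv (schwartzDeriv₂ φ) (G τ)) (t - τ) x

/-- The Duhamel integral with source `φ ∗ G`. -/
def duhamel (φ : 𝓢(ℝ, ℝ)) (G : ℝ → ℝ → ℂ) (t x : ℝ) : ℂ :=
  ∫ τ in (0 : ℝ)..t, duhamelIntegrand φ G t τ x

section Duhamel

variable {G : ℝ → ℝ → ℂ} {B : ℝ}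

lemma continuous_duhamelIntegrand (φ : 𝓢(ℝ, ℝ)) (hG : Continuous fun p : ℝ × ℝ => G p.1 p.2)
    (hB : ∀ τ x, ‖G τ x‖ ≤ B) :
    Continuous fun p : ℝ × ℝ × ℝ => duhamelIntegrand φ G p.1 p.2.1 p.2.2 := by
  have c0 := continuous_conv φ hG hB
  have c2 := continuous_conv (schwartzDeriv₂ φ) hG hB
  refine (c0.comp (by fun_prop : Continuous fun p : ℝ × ℝ × ℝ => (p.2.1, p.2.2))).add ?_
  refine continuous_integral_correctionKernel_mul (s := fun p : ℝ × ℝ × ℝ => p.1 - p.2.1)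
    (by fun_prop) (G := fun p y => conv (schwartzDeriv₂ φ) (G p.2.1) (p.2.2 - y)) ?_
    (fun p y => norm_conv_le _ (hB p.2.1) _)
  exact c2.comp (by fun_prop : Continuous fun p : (ℝ × ℝ × ℝ) × ℝ => (p.1.2.1, p.1.2.2 - p.2))

lemma isBoundedC2_conv_slice (φ : 𝓢(ℝ, ℝ)) (hG : Continuous fun p : ℝ × ℝ => G p.1 p.2)
    (hB : ∀ τ x, ‖G τ x‖ ≤ B) (τ : ℝ) :
    IsBoundedC2 (conv φ (G τ)) (conv (SchwartzMap.derivCLM ℝ ℝ φ) (G τ))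
      (conv (schwartzDeriv₂ φ) (G τ)) (schwartzL1 φ * B) (schwartzL1 (schwartzDeriv₂ φ) * B) :=
  isBoundedC2_conv φ (hG.comp (by fun_prop : Continuous fun x => (τ, x))) (hB τ)

/-- The constant depends on `φ` alone, so the estimate applies equally to a source and to a
difference of sources. -/
lemma exists_norm_duhamelIntegrand_le (φ : 𝓢(ℝ, ℝ)) :
    ∃ κ : ℝ, 0 ≤ κ ∧ ∀ {G : ℝ → ℝ → ℂ} {B : ℝ}, (Continuous fun p : ℝ × ℝ => G p.1 p.2) →
      (∀ τ x, ‖G τ x‖ ≤ B) → ∀ t τ x : ℝ, t - τ ≤ 1 → ‖duhamelIntegrand φ G t τ x‖ ≤ κ * B := by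
  obtain ⟨A, hA, h⟩ := exists_norm_smoothEvolution_le
  refine ⟨schwartzL1 φ + A * schwartzL1 (schwartzDeriv₂ φ),
    add_nonneg (schwartzL1_nonneg _) (mul_nonneg hA.le (schwartzL1_nonneg _)),
    fun hG hB t τ x ht => ?_⟩
  refine (h (isBoundedC2_conv_slice φ hG hB τ) (t - τ) ht x).trans (le_of_eq ?_)
  ring

lemma continuous_duhamel (φ : 𝓢(ℝ, ℝ)) (hG : Continuous fun p : ℝ × ℝ => G p.1 p.2)
    (hB : ∀ τ x, ‖G τ x‖ ≤ B) : Continuous fun p : ℝ × ℝ => duhamel φ G p.1 p.2 := by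
  refine intervalIntegral.continuous_parametric_intervalIntegral_of_continuous
    (f := fun (p : ℝ × ℝ) τ => duhamelIntegrand φ G p.1 τ p.2) (s := fun p => p.1) ?_ (by fun_prop)
  exact (continuous_duhamelIntegrand φ hG hB).comp
    (by fun_prop : Continuous fun q : (ℝ × ℝ) × ℝ => (q.1.1, q.2, q.1.2))

lemma intervalIntegrable_duhamelIntegrand (φ : 𝓢(ℝ, ℝ))
    (hG : Continuous fun p : ℝ × ℝ => G p.1 p.2) (hB : ∀ τ x, ‖G τ x‖ ≤ B) (t x a b : ℝ) :
    IntervalIntegrable (fun τ => duhamelIntegrand φ G t τ x) volume a b :=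
  ((continuous_duhamelIntegrand φ hG hB).comp
    (by fun_prop : Continuous fun τ : ℝ => (t, τ, x))).intervalIntegrable _ _

lemma duhamel_sub (φ : 𝓢(ℝ, ℝ)) {H : ℝ → ℝ → ℂ} {N : ℝ}
    (hG : Continuous fun p : ℝ × ℝ => G p.1 p.2) (hB : ∀ τ x, ‖G τ x‖ ≤ B)
    (hH : Continuous fun p : ℝ × ℝ => H p.1 p.2) (hN : ∀ τ x, ‖H τ x‖ ≤ N) (t x : ℝ) :
    duhamel φ G t x - duhamel φ H t x = duhamel φ (fun τ y => G τ y - H τ y) t x := by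
  rw [duhamel, duhamel, duhamel, ← intervalIntegral.integral_sub
    (intervalIntegrable_duhamelIntegrand φ hG hB t x 0 t)
    (intervalIntegrable_duhamelIntegrand φ hH hN t x 0 t)]
  refine intervalIntegral.integral_congr fun τ _ => ?_
  have g : Continuous (G τ) := hG.comp (by fun_prop : Continuous fun x => (τ, x))
  have h : Continuous (H τ) := hH.comp (by fun_prop : Continuous fun x => (τ, x))
  have hGc := isBoundedC2_conv_slice φ hG hB τ
  have hHc := isBoundedC2_conv_slice φ hH hN τ
  have cG := hGc.continuous''
  have cH := hHc.continuous''
  simp only [duhamelIntegrand, smoothEvolution, conv_sub _ g h (hB τ) (hN τ), mul_sub]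
  rw [integral_sub (integrable_correctionKernel_mul _ (by fun_prop) fun y => hGc.bound'' _)
    (integrable_correctionKernel_mul _ (by fun_prop) fun y => hHc.bound'' _)]
  ring

end Duhamel

/-- The function `|φ ∗ u|² (φ ∗ u)`, with the convolutions taken in space. -/
def cubicSource (φ : 𝓢(ℝ, ℝ)) (u : ℝ → ℝ → ℂ) (τ x : ℝ) : ℂ := cubic (conv φ (u τ) x)

lemma continuous_cubicSource (φ : 𝓢(ℝ, ℝ)) {u : ℝ → ℝ → ℂ} {r : ℝ}
    (hu : Continuous fun p : ℝ × ℝ => u p.1 p.2) (hr : ∀ t x, ‖u t x‖ ≤ r) :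
    Continuous fun p : ℝ × ℝ => cubicSource φ u p.1 p.2 :=
  continuous_cubic.comp (continuous_conv φ hu hr)

lemma norm_cubicSource_sub_le (φ : 𝓢(ℝ, ℝ)) {u v : ℝ → ℝ → ℂ} {r d : ℝ}
    (hu : Continuous fun p : ℝ × ℝ => u p.1 p.2) (hur : ∀ t x, ‖u t x‖ ≤ r)
    (hv : Continuous fun p : ℝ × ℝ => v p.1 p.2) (hvr : ∀ t x, ‖v t x‖ ≤ r)
    (hd : ∀ t x, ‖u t x - v t x‖ ≤ d) (t x : ℝ) :
    ‖cubicSource φ u t x - cubicSource φ v t x‖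
      ≤ 3 * (schwartzL1 φ * r) ^ 2 * (schwartzL1 φ * d) := by
  refine (norm_cubic_sub_le (norm_conv_le φ (hur t) x) (norm_conv_le φ (hvr t) x)).trans ?_
  rw [← conv_sub φ (f := u t) (g := v t) (hu.comp (by fun_prop : Continuous fun x => (t, x)))
    (hv.comp (by fun_prop : Continuous fun x => (t, x))) (hur t) (hvr t)]
  gcongr
  exact norm_conv_le φ (hd t) x

lemma norm_cubicSource_le (φ : 𝓢(ℝ, ℝ)) {u : ℝ → ℝ → ℂ} {r : ℝ} (hr : 0 ≤ r)
    (hu : Continuous fun p : ℝ × ℝ => u p.1 p.2) (hur : ∀ t x, ‖u t x‖ ≤ r) (t x : ℝ) :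
    ‖cubicSource φ u t x‖ ≤ 3 * (schwartzL1 φ * r) ^ 2 * (schwartzL1 φ * r) := by
  have := norm_cubicSource_sub_le φ hu hur (v := fun _ _ => 0) (d := r) (by fun_prop)
    (by simpa using hr) (by simpa using hur) t x
  have h0 : cubicSource φ (fun _ _ => 0) t x = 0 := by
    simp [cubicSource, conv_apply, cubic_zero]
  rwa [h0, sub_zero] at this

/-! ### Local existence -/

/-- Local existence for the Duhamel equation, by the contraction principle in the space of bounded
continuous functions. -/
lemma exists_mild_solution (φ : 𝓢(ℝ, ℝ)) (M₀ M₂ : ℝ) :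
    ∃ T : ℝ, 0 < T ∧ T ≤ 1 ∧ ∀ {f f' f'' : ℝ → ℂ}, IsBoundedC2 f f' f'' M₀ M₂ →
      ∃ u : ℝ → ℝ → ℂ, (Continuous fun p : ℝ × ℝ => u p.1 p.2) ∧ (∃ r, ∀ t x, ‖u t x‖ ≤ r) ∧
        ∀ t ∈ Icc 0 T, ∀ x,
          u t x = smoothEvolution f f'' t x - I * duhamel φ (cubicSource φ u) t x := by
  obtain ⟨A, hA, hS⟩ := exists_norm_smoothEvolution_le
  obtain ⟨κ, hκ, hD⟩ := exists_norm_duhamelIntegrand_le φ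
  set c := schwartzL1 φ with hc
  have hc0 : 0 ≤ c := schwartzL1_nonneg φ
  -- Twice the bound on the free evolution: half of the ball is left for the Duhamel term. Absolute
  -- values keep `r` nonnegative for every choice of `M₀`, `M₂`.
  set r : ℝ := 2 * (|M₀| + A * |M₂|) with hr
  have hr0 : 0 ≤ r := by positivity
  set Λ : ℝ := κ * (3 * (c * r) ^ 2 * c) with hΛ
  have hΛ0 : 0 ≤ Λ := by positivity
  -- `Λ` is the Lipschitz constant per unit time of the Duhamel term on the ball, so `T * Λ ≤ 1 /
  -- 2`. The bounds on the evolution hold for times up to `1`.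
  set T : ℝ := min 1 (1 / (2 * (Λ + 1))) with hT
  have hT0 : 0 < T := by positivity
  have hT1 : T ≤ 1 := min_le_left _ _
  have hTΛ : T * Λ ≤ 1 / 2 := by
    calc T * Λ ≤ 1 / (2 * (Λ + 1)) * Λ := by gcongr; exact min_le_right _ _
      _ ≤ 1 / 2 := by
        rw [div_mul_eq_mul_div, div_le_div_iff₀ (by positivity) (by norm_num)]; linarith
  -- Used twice: `d = r` shows that the ball is preserved, and `d = dist U V` gives the contraction.
  have hduh : ∀ {G : ℝ → ℝ → ℂ} {d : ℝ}, 0 ≤ d → (Continuous fun p : ℝ × ℝ => G p.1 p.2) →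
      (∀ τ x, ‖G τ x‖ ≤ 3 * (c * r) ^ 2 * (c * d)) → ∀ t ∈ Icc 0 T, ∀ x,
      ‖duhamel φ G t x‖ ≤ 1 / 2 * d := by
    intro G d hd hG hB t ht x
    have := intervalIntegral.norm_integral_le_of_norm_le_const (a := 0) (b := t)
      (f := fun τ => duhamelIntegrand φ G t τ x) (C := κ * (3 * (c * r) ^ 2 * (c * d)))
      (fun τ hτ => hD hG hB t τ x (by
        rw [uIoc_of_le ht.1] at hτ
        linarith [hτ.1, ht.2]))
    refine this.trans ?_
    rw [sub_zero, abs_of_nonneg ht.1]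
    calc _ = t * Λ * d := by rw [hΛ]; ring
      _ ≤ T * Λ * d := by gcongr; exact ht.2
      _ ≤ _ := by gcongr
  refine ⟨T, hT0, hT1, fun {f f' f''} hf => ?_⟩
  have hSr : ∀ t ≤ 1, ∀ x, ‖smoothEvolution f f'' t x‖ ≤ r / 2 := fun t ht x => by
    refine (hS hf t ht x).trans ?_
    rw [hr]
    have := mul_le_mul_of_nonneg_left (le_abs_self M₂) hA.le
    linarith [le_abs_self M₀]
  -- Clamping time to `[0, T]` lets the iteration run on bounded continuous functions on all of `ℝ ×
  -- ℝ`.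
  set cl : ℝ → ℝ := fun t => max 0 (min t T) with hcl
  have hclc : Continuous cl := by fun_prop
  have hclm : ∀ t, cl t ∈ Icc 0 T := fun t => ⟨le_max_left _ _, max_le hT0.le (min_le_right _ _)⟩
  have hcle : ∀ t ∈ Icc 0 T, cl t = t := fun t ht => by
    simp [hcl, min_eq_left ht.2, max_eq_right ht.1]
  let E := BoundedContinuousFunction (ℝ × ℝ) ℂ
  have hEc : ∀ U : E, Continuous fun p : ℝ × ℝ => U (p.1, p.2) := fun U => U.continuous
  have hEb : ∀ U : E, ∀ t x, ‖U (t, x)‖ ≤ ‖U‖ := fun U t x => U.norm_coe_le_norm _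
  have hex : ∀ U : E, ∃ V : E, ∀ p, V p = smoothEvolution f f'' (cl p.1) p.2
      - I * duhamel φ (cubicSource φ fun t x => U (t, x)) (cl p.1) p.2 := by
    intro U
    have gc := continuous_cubicSource φ (hEc U) (hEb U)
    have gb := norm_cubicSource_le φ (norm_nonneg U) (hEc U) (hEb U)
    refine ⟨BoundedContinuousFunction.ofNormedAddCommGroup (fun p =>
      smoothEvolution f f'' (cl p.1) p.2 - I * duhamel φ (cubicSource φ fun t x => U (t, x)) (cl p.1) p.2) ?_
      (r / 2 + κ * (3 * (schwartzL1 φ * ‖U‖) ^ 2 * (schwartzL1 φ * ‖U‖))) ?_, fun p => rfl⟩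
    · exact (hf.continuous_smoothEvolution.comp (by fun_prop : Continuous fun p : ℝ × ℝ =>
        (cl p.1, p.2))).sub (continuous_const.mul ((continuous_duhamel φ gc gb).comp
          (by fun_prop : Continuous fun p : ℝ × ℝ => (cl p.1, p.2))))
    · intro p
      have hp := hclm p.1
      refine (norm_sub_le _ _).trans (add_le_add (hSr _ (hp.2.trans hT1) _) ?_)
      rw [norm_mul, norm_I, one_mul]
      refine (intervalIntegral.norm_integral_le_of_norm_le_const
        (fun τ hτ => hD gc gb (cl p.1) τ p.2 (by
          rw [uIoc_of_le hp.1] at hτ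
          linarith [hτ.1, hp.2]))).trans ?_
      rw [sub_zero, abs_of_nonneg hp.1]
      exact mul_le_of_le_one_right (by positivity) (hp.2.trans hT1)
  choose Γ hΓ using hex
  have hball : ∀ {U : E}, U ∈ Metric.closedBall (0 : E) r → ∀ t x, ‖U (t, x)‖ ≤ r := by
    intro U hU t x
    rw [mem_closedBall_zero_iff] at hU
    exact (hEb U t x).trans hU
  have hmaps : MapsTo Γ (Metric.closedBall (0 : E) r) (Metric.closedBall (0 : E) r) := by
    intro U hU
    rw [mem_closedBall_zero_iff, BoundedContinuousFunction.norm_le hr0]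
    intro p
    have hp := hclm p.1
    rw [hΓ]
    refine (norm_sub_le _ _).trans ?_
    rw [norm_mul, norm_I, one_mul]
    have h1 := hSr _ (hp.2.trans hT1) p.2
    have h2 := hduh hr0 (continuous_cubicSource φ (hEc U) (hEb U))
      (norm_cubicSource_le φ hr0 (hEc U) (hball hU)) _ hp p.2
    linarith
  have hcontr : ContractingWith (1 / 2 : NNReal) (hmaps.restrict Γ _ _) := by
    refine ⟨by norm_num [div_lt_one], LipschitzWith.of_dist_le_mul ?_⟩
    rintro ⟨U, hU⟩ ⟨V, hV⟩
    rw [Subtype.dist_eq, Subtype.dist_eq]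
    simp only [MapsTo.val_restrict_apply]
    rw [BoundedContinuousFunction.dist_le (by positivity)]
    intro p
    have gU := continuous_cubicSource φ (hEc U) (hEb U)
    have bU := norm_cubicSource_le φ (norm_nonneg U) (hEc U) (hEb U)
    have gV := continuous_cubicSource φ (hEc V) (hEb V)
    have bV := norm_cubicSource_le φ (norm_nonneg V) (hEc V) (hEb V)
    have hdist : ∀ t x, ‖U (t, x) - V (t, x)‖ ≤ dist U V := fun t x => by
      rw [← dist_eq_norm]
      exact BoundedContinuousFunction.dist_coe_le_dist _
    have key := hduh (d := dist U V) dist_nonneg (gU.sub gV)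
      (norm_cubicSource_sub_le φ (hEc U) (hball hU) (hEc V) (hball hV) hdist) _ (hclm p.1) p.2
    rw [dist_eq_norm, hΓ, hΓ, sub_sub_sub_cancel_left, ← mul_sub, norm_mul, norm_I, one_mul,
      norm_sub_rev, duhamel_sub φ gU bU gV bV]
    simpa using key
  obtain ⟨U, hU, hfix, -⟩ := hcontr.exists_fixedPoint' Metric.isClosed_closedBall.isComplete hmaps
    (x := 0) (Metric.mem_closedBall_self hr0) (edist_ne_top _ _)
  refine ⟨fun t x => U (t, x), hEc U, ⟨r, hball hU⟩, fun t ht x => ?_⟩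
  have := hΓ U (t, x)
  rw [hfix] at this
  simpa only [hcle t ht] using this

/-! ### Uniform continuity in space-time -/

lemma IsBoundedC2.norm_smoothEvolution_sub_le {f f' f'' : ℝ → ℂ} {M₀ M₂ : ℝ}
    (hf : IsBoundedC2 f f' f'' M₀ M₂) (s s' x x' : ℝ) :
    ‖smoothEvolution f f'' s x - smoothEvolution f f'' s' x'‖
      ≤ (2 * M₀ + M₂) * |x - x'| + M₂ * kernelModulus s s' (x - x') := by
  have h1 : ‖f x - f x'‖ ≤ (2 * M₀ + M₂) * ‖x - x'‖ :=
    convex_univ.norm_image_sub_le_of_norm_hasDerivWithin_le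
      (fun w _ => (hf.hasDerivAt w).hasDerivWithinAt) (fun w _ => hf.norm_deriv_le w) (mem_univ x')
      (mem_univ x)
  have h2 := norm_integral_correctionKernel_sub_le s s' x x' hf.continuous'' hf.bound''
  rw [smoothEvolution, smoothEvolution, add_sub_add_comm]
  exact (norm_add_le _ _).trans (add_le_add h1 h2)

/-- The free evolution is uniformly continuous in space-time, uniformly for data bounded in `C²`. -/
lemma exists_modulus_smoothEvolution (M₀ M₂ T : ℝ) {ε : ℝ} (hε : 0 < ε) :
    ∃ δ > 0, ∀ {f f' f'' : ℝ → ℂ}, IsBoundedC2 f f' f'' M₀ M₂ →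
      ∀ s ∈ Icc 0 T, ∀ s' ∈ Icc 0 T, ∀ x x' : ℝ, |s - s'| < δ → |x - x'| < δ →
        ‖smoothEvolution f f'' s x - smoothEvolution f f'' s' x'‖ ≤ ε := by
  set N : ℝ := |2 * M₀ + M₂| + |M₂| + 1 with hN
  have hN0 : 0 < N := by positivity
  obtain ⟨δ, hδ, hd⟩ := kernelModulus_uniform T (ε := ε / (2 * N)) (by positivity)
  refine ⟨min δ (ε / (2 * N)), by positivity, fun hf s hs s' hs' x x' h1 h2 => ?_⟩
  refine (hf.norm_smoothEvolution_sub_le s s' x x').trans ?_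
  have hk := (hd s hs s' hs' (x - x') (h1.trans_le (min_le_left _ _))
    (h2.trans_le (min_le_left _ _))).le
  have hk0 : 0 ≤ kernelModulus s s' (x - x') := integral_nonneg fun _ => norm_nonneg _
  have hx := (h2.trans_le (min_le_right _ _)).le
  have hN1 : 2 * M₀ + M₂ ≤ N := by
    rw [hN]; linarith [le_abs_self (2 * M₀ + M₂), abs_nonneg M₂]
  have hN2 : M₂ ≤ N := by
    rw [hN]; linarith [le_abs_self M₂, abs_nonneg (2 * M₀ + M₂)]
  calc _ ≤ N * |x - x'| + N * kernelModulus s s' (x - x') := by gcongr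
    _ ≤ N * (ε / (2 * N)) + N * (ε / (2 * N)) := by gcongr
    _ = ε := by field_simp; norm_num

lemma uniformContinuousOn_smoothEvolution {f f' f'' : ℝ → ℂ} {M₀ M₂ : ℝ}
    (hf : IsBoundedC2 f f' f'' M₀ M₂) (T : ℝ) :
    UniformContinuousOn (fun p : ℝ × ℝ => smoothEvolution f f'' p.1 p.2) (Icc 0 T ×ˢ univ) := by
  rw [Metric.uniformContinuousOn_iff_le]
  intro ε hε
  obtain ⟨δ, hδ, hd⟩ := exists_modulus_smoothEvolution M₀ M₂ T hε
  refine ⟨δ / 2, by positivity, fun p hp q hq hpq => ?_⟩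
  rw [Prod.dist_eq, max_le_iff, Real.dist_eq, Real.dist_eq] at hpq
  rw [dist_eq_norm]
  exact hd hf _ hp.1 _ hq.1 _ _ (by linarith [hpq.1]) (by linarith [hpq.2])

lemma uniformContinuousOn_duhamel (φ : 𝓢(ℝ, ℝ)) {G : ℝ → ℝ → ℂ} {B : ℝ}
    (hG : Continuous fun p : ℝ × ℝ => G p.1 p.2) (hB : ∀ τ x, ‖G τ x‖ ≤ B) {T : ℝ} (hT : T ≤ 1) :
    UniformContinuousOn (fun p : ℝ × ℝ => duhamel φ G p.1 p.2) (Icc 0 T ×ˢ univ) := by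
  obtain ⟨κ, hκ, hD⟩ := exists_norm_duhamelIntegrand_le φ
  have hB0 : 0 ≤ B := (norm_nonneg _).trans (hB 0 0)
  rw [Metric.uniformContinuousOn_iff_le]
  intro ε hε
  obtain ⟨δ, hδ, hd⟩ := exists_modulus_smoothEvolution (schwartzL1 φ * B)
    (schwartzL1 (schwartzDeriv₂ φ) * B) T (half_pos hε)
  have key : ∀ t ∈ Icc 0 T, ∀ t' ∈ Icc 0 T, t' ≤ t → ∀ x x', |t - t'| < δ → |x - x'| < δ →
      |t - t'| ≤ ε / (2 * (κ * B + 1)) → ‖duhamel φ G t x - duhamel φ G t' x'‖ ≤ ε := by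
    intro t ht t' ht' htt x x' h1 h2 h3
    have i1 := intervalIntegrable_duhamelIntegrand φ hG hB t x
    have i2 := intervalIntegrable_duhamelIntegrand φ hG hB t' x'
    -- On `[0, t']` the integrands are compared by a modulus common to all `τ`; the remaining
    -- interval `[t', t]` is short and its integrand bounded.
    have he : duhamel φ G t x - duhamel φ G t' x'
        = (∫ τ in (0 : ℝ)..t', (duhamelIntegrand φ G t τ x - duhamelIntegrand φ G t' τ x'))
          + ∫ τ in t'..t, duhamelIntegrand φ G t τ x := by
      rw [duhamel, duhamel, ← intervalIntegral.integral_add_adjacent_intervals (i1 0 t') (i1 t' t),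
        intervalIntegral.integral_sub (i1 0 t') (i2 0 t')]
      ring
    have b1 : ‖∫ τ in (0 : ℝ)..t', (duhamelIntegrand φ G t τ x - duhamelIntegrand φ G t' τ x')‖
        ≤ ε / 2 * |t' - 0| :=
      intervalIntegral.norm_integral_le_of_norm_le_const fun τ hτ => by
        rw [uIoc_of_le ht'.1] at hτ
        exact hd (isBoundedC2_conv_slice φ hG hB τ) (t - τ)
          ⟨by linarith [hτ.2], by linarith [hτ.1, ht.2]⟩ (t' - τ)
          ⟨by linarith [hτ.2], by linarith [hτ.1, ht'.2]⟩ x x' (by simpa using h1) h2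
    have b2 : ‖∫ τ in t'..t, duhamelIntegrand φ G t τ x‖ ≤ κ * B * |t - t'| :=
      intervalIntegral.norm_integral_le_of_norm_le_const fun τ hτ => by
        rw [uIoc_of_le htt] at hτ
        exact hD hG hB t τ x (by linarith [hτ.1, ht.2, ht'.1])
    rw [he]
    refine (norm_add_le _ _).trans ?_
    have b3 : ε / 2 * |t' - 0| ≤ ε / 2 :=
      mul_le_of_le_one_right (by positivity) (by
        rw [sub_zero, abs_of_nonneg ht'.1]; exact ht'.2.trans hT)
    have b4 : κ * B * |t - t'| ≤ ε / 2 := by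
      calc _ ≤ (κ * B + 1) * (ε / (2 * (κ * B + 1))) := by gcongr; linarith
        _ = ε / 2 := by field_simp
    linarith
  refine ⟨min (δ / 2) (ε / (2 * (κ * B + 1))), by positivity, fun p hp q hq hpq => ?_⟩
  rw [Prod.dist_eq, max_le_iff, Real.dist_eq, Real.dist_eq, le_min_iff, le_min_iff] at hpq
  obtain ⟨⟨h1, h2⟩, h3, -⟩ := hpq
  rw [dist_eq_norm]
  rcases le_total q.1 p.1 with h | h
  · exact key _ hp.1 _ hq.1 h _ _ (by linarith) (by linarith) h2
  · rw [norm_sub_rev]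
    rw [abs_sub_comm] at h1 h2 h3
    exact key _ hq.1 _ hp.1 h _ _ (by linarith) (by linarith) h2

/-! ### The weak equation for mild solutions -/

lemma hasDerivAt_slice_fst {Φ : ℝ × ℝ → ℂ} (hΦ : ContDiff ℝ ∞ Φ) (t x : ℝ) :
    HasDerivAt (fun s => Φ (s, x)) (fderiv ℝ Φ (t, x) (1, 0)) t := by
  have h1 := (hΦ.differentiable (by simp) (t, x)).hasFDerivAt
  exact h1.comp_hasDerivAt t ((hasDerivAt_id t).prodMk (hasDerivAt_const t x))

lemma hasDerivAt_slice_snd {Φ : ℝ × ℝ → ℂ} (hΦ : ContDiff ℝ ∞ Φ) (t x : ℝ) :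
    HasDerivAt (fun y => Φ (t, y)) (fderiv ℝ Φ (t, x) (0, 1)) x := by
  have h1 := (hΦ.differentiable (by simp) (t, x)).hasFDerivAt
  exact h1.comp_hasDerivAt x ((hasDerivAt_const x t).prodMk (hasDerivAt_id x))

lemma contDiff_fderiv_apply {Φ : ℝ × ℝ → ℂ} (hΦ : ContDiff ℝ ∞ Φ) (v : ℝ × ℝ) :
    ContDiff ℝ ∞ fun p => fderiv ℝ Φ p v :=
  (hΦ.fderiv_right (m := ∞) (by simp)).clm_apply contDiff_const

lemma fderiv_eq_zero_of_notMem_tsupport {Φ : ℝ × ℝ → ℂ} {p : ℝ × ℝ} (hp : p ∉ tsupport Φ) :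
    fderiv ℝ Φ p = 0 :=
  image_eq_zero_of_notMem_tsupport fun h => hp (tsupport_fderiv_subset ℝ h)

lemma tsupport_fderiv_apply_subset (Φ : ℝ × ℝ → ℂ) (v : ℝ × ℝ) :
    tsupport (fun p => fderiv ℝ Φ p v) ⊆ tsupport Φ :=
  closure_minimal (fun p hp => by
    by_contra h
    exact hp (by simp [fderiv_eq_zero_of_notMem_tsupport h])) (isClosed_tsupport Φ)

lemma exists_testJet {Ψ : ℝ × ℝ → ℂ} (hΨ : ContDiff ℝ ∞ Ψ) (hc : HasCompactSupport Ψ) {T : ℝ}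
    (hT : tsupport Ψ ⊆ Ioo 0 T ×ˢ univ) :
    ∃ R, 0 ≤ R ∧ TestJet (fun t x => Ψ (t, x)) (fun t x => deriv (fun s => Ψ (s, x)) t)
      (fun t x => deriv (fun y => Ψ (t, y)) x) (fun t x => iteratedDeriv 2 (fun y => Ψ (t, y)) x)
      T R ∧ ∀ t x, t ≤ 0 → Ψ (t, x) = 0 ∧ deriv (fun s => Ψ (s, x)) t = 0
        ∧ iteratedDeriv 2 (fun y => Ψ (t, y)) x = 0 := by
  set Ψt := fun p => fderiv ℝ Ψ p (1, 0) with hΨt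
  set Ψx := fun p => fderiv ℝ Ψ p (0, 1) with hΨx
  set Ψxx := fun p => fderiv ℝ Ψx p (0, 1) with hΨxx
  have ct : ContDiff ℝ ∞ Ψt := contDiff_fderiv_apply hΨ _
  have cx : ContDiff ℝ ∞ Ψx := contDiff_fderiv_apply hΨ _
  have cxx : ContDiff ℝ ∞ Ψxx := contDiff_fderiv_apply cx _
  have et : ∀ t x, deriv (fun s => Ψ (s, x)) t = Ψt (t, x) := fun t x =>
    (hasDerivAt_slice_fst hΨ t x).deriv
  have ex : ∀ t x, deriv (fun y => Ψ (t, y)) x = Ψx (t, x) := fun t x =>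
    (hasDerivAt_slice_snd hΨ t x).deriv
  have exx : ∀ t x, iteratedDeriv 2 (fun y => Ψ (t, y)) x = Ψxx (t, x) := fun t x => by
    rw [iteratedDeriv_succ, iteratedDeriv_one]
    simp only [funext (ex t)]
    exact (hasDerivAt_slice_snd cx t x).deriv
  have hz : ∀ p, p ∉ tsupport Ψ → Ψ p = 0 ∧ Ψt p = 0 ∧ Ψx p = 0 ∧ Ψxx p = 0 := by
    intro p hp
    have h1 := fderiv_eq_zero_of_notMem_tsupport hp
    have h2 : fderiv ℝ Ψx p = 0 :=
      fderiv_eq_zero_of_notMem_tsupport fun h => hp (tsupport_fderiv_apply_subset Ψ _ h)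
    exact ⟨image_eq_zero_of_notMem_tsupport hp, by simp [hΨt, h1], by simp [hΨx, h1],
      by simp [hΨxx, h2]⟩
  obtain ⟨R, hR⟩ := hc.isCompact.isBounded.exists_norm_le
  simp only [et, ex, exx]
  refine ⟨|R| + 1, by positivity, ⟨hΨ.continuous, ct.continuous, cx.continuous, cxx.continuous,
    hasDerivAt_slice_fst hΨ, hasDerivAt_slice_snd hΨ, hasDerivAt_slice_snd cx, ?_⟩, ?_⟩
  · intro t x h
    refine hz (t, x) fun hp => ?_
    rcases h with h | h
    · exact absurd (hT hp).1.2 (not_lt.2 h)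
    · have h1 := (norm_snd_le (t, x)).trans (hR _ hp)
      rw [Real.norm_eq_abs] at h1
      linarith [le_abs_self R]
  · intro t x h
    obtain ⟨h1, h2, -, h4⟩ := hz (t, x) fun hp => absurd (hT hp).1.1 (not_lt.2 h)
    exact ⟨h1, h2, h4⟩

lemma integral_eq_integral_strip {F : ℝ × ℝ → ℂ} {T : ℝ} (h0 : ∀ t x, t ≤ 0 → F (t, x) = 0)
    (hT : ∀ t x, T ≤ t → F (t, x) = 0) :
    ∫ p, F p = ∫ p, F p ∂((volume.restrict (Ioc 0 T)).prod (volume : Measure ℝ)) := by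
  have h3 : (volume.restrict (Ioc 0 T)).prod (volume : Measure ℝ)
      = (volume : Measure (ℝ × ℝ)).restrict (Ioc 0 T ×ˢ univ) := by
    rw [Measure.volume_eq_prod, ← Measure.prod_restrict, Measure.restrict_univ]
  rw [h3]
  refine (setIntegral_eq_integral_of_forall_compl_eq_zero ?_).symm
  rintro ⟨t, x⟩ hp
  rcases le_or_gt t 0 with h | h
  · exact h0 t x h
  · refine hT t x ?_
    by_contra! h'
    exact hp ⟨⟨h, h'.le⟩, mem_univ _⟩

/-- The Duhamel integral solves the inhomogeneous Schrödinger equation weakly. -/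
lemma integral_duhamel_mul_test (φ : 𝓢(ℝ, ℝ)) {G : ℝ → ℝ → ℂ} {B : ℝ}
    (hG : Continuous fun p : ℝ × ℝ => G p.1 p.2) (hB : ∀ τ x, ‖G τ x‖ ≤ B) {T : ℝ} (hT : T ≤ 1)
    {h ht hx hxx : ℝ → ℝ → ℂ} {R : ℝ} (hh : TestJet h ht hx hxx T R) (hR : 0 ≤ R) :
    ∫ p, duhamel φ G p.1 p.2 * (-I * ht p.1 p.2 + hxx p.1 p.2)
        ∂((volume.restrict (Ioc 0 T)).prod (volume : Measure ℝ))
      = I * ∫ p, conv φ (G p.1) p.2 * h p.1 p.2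
        ∂((volume.restrict (Ioc 0 T)).prod (volume : Measure ℝ)) := by
  obtain ⟨κ, hκ, hD⟩ := exists_norm_duhamelIntegrand_le φ
  have hB0 : 0 ≤ B := (norm_nonneg _).trans (hB 0 0)
  set ν := (volume.restrict (Ioc 0 T)).prod (volume : Measure ℝ) with hν
  have c0 := hh.continuous
  have c1 := hh.continuous_t
  have c2 := hh.continuous_xx
  set P : ℝ × ℝ → ℂ := fun p => -I * ht p.1 p.2 + hxx p.1 p.2 with hP
  have cP : Continuous P := by fun_prop
  have zP : ∀ t x, R ≤ |x| → P (t, x) = 0 := fun t x hx => by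
    obtain ⟨-, h1, -, h2⟩ := hh.eq_zero t x (Or.inr hx)
    simp [hP, h1, h2]
  have iP : Integrable P ν := integrable_strip cP zP T
  have cD := continuous_duhamelIntegrand φ hG hB
  have hνIoc : ∀ᵐ p ∂ν, p.1 ∈ Ioc 0 T :=
    (Measure.quasiMeasurePreserving_fst (μ := volume.restrict (Ioc 0 T)) (ν := volume)).ae
      (ae_restrict_mem measurableSet_Ioc)
  -- The cutoff extends the integrand from the region `τ ≤ t` to a product domain, where Fubini
  -- applies.
  set K : ℝ × ℝ → ℝ → ℂ := fun p τ => if τ ≤ p.1 then duhamelIntegrand φ G p.1 τ p.2 * P p else 0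
    with hK
  have hKi : Integrable (Function.uncurry K) (ν.prod (volume.restrict (Ioc 0 T))) := by
    refine (iP.norm.mul_prod (integrable_const (κ * B))).mono' ?_ ?_
    · have hcont : Continuous fun q : (ℝ × ℝ) × ℝ =>
          duhamelIntegrand φ G q.1.1 q.2 q.1.2 * P q.1 :=
        (cD.comp (by fun_prop : Continuous fun q : (ℝ × ℝ) × ℝ => (q.1.1, q.2, q.1.2))).mul
          (cP.comp continuous_fst)
      exact (Measurable.ite (measurableSet_le measurable_snd (measurable_fst.comp measurable_fst))
        hcont.measurable measurable_const).aestronglyMeasurable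
    · have h1 : ∀ᵐ q ∂(ν.prod (volume.restrict (Ioc 0 T))), q.1.1 ∈ Ioc 0 T :=
        (Measure.quasiMeasurePreserving_fst (μ := ν) (ν := volume.restrict (Ioc 0 T))).ae hνIoc
      have h2 : ∀ᵐ q ∂(ν.prod (volume.restrict (Ioc 0 T))), q.2 ∈ Ioc 0 T :=
        (Measure.quasiMeasurePreserving_snd (μ := ν) (ν := volume.restrict (Ioc 0 T))).ae
          (ae_restrict_mem measurableSet_Ioc)
      filter_upwards [h1, h2] with q hq1 hq2
      simp only [Function.uncurry, hK]
      split_ifs with hle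
      · rw [norm_mul, mul_comm]
        exact mul_le_mul_of_nonneg_left (hD hG hB _ _ _ (by linarith [hq1.2, hq2.1]))
          (norm_nonneg _)
      · rw [norm_zero]; positivity
  have e1 : ∫ p, duhamel φ G p.1 p.2 * P p ∂ν = ∫ p, (∫ τ in Ioc 0 T, K p τ) ∂ν := by
    refine integral_congr_ae ?_
    filter_upwards [hνIoc] with p hp
    have hKind : K p = (Iic p.1).indicator fun τ => duhamelIntegrand φ G p.1 τ p.2 * P p := by
      funext τ
      simp only [hK, indicator, mem_Iic]
    rw [hKind, setIntegral_indicator measurableSet_Iic, Ioc_inter_Iic, min_eq_right hp.2,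
      integral_mul_const, ← intervalIntegral.integral_of_le hp.1.le, duhamel]
  -- For fixed `τ` the integrand is a free evolution started at time `τ`; its weak formulation
  -- leaves the initial term.
  have e2 : ∀ τ ∈ Ioc 0 T, ∫ p, K p τ ∂ν = I * ∫ x, conv φ (G τ) x * h τ x := by
    intro τ hτ
    have hKτ : (fun p => K p τ) = (Ici τ ×ˢ univ).indicator
        fun p => duhamelIntegrand φ G p.1 τ p.2 * P p := by
      funext p
      simp only [hK, indicator, mem_prod, mem_Ici, mem_univ, and_true]
    have cF : Continuous fun p : ℝ × ℝ => duhamelIntegrand φ G p.1 τ p.2 * P p :=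
      (cD.comp (by fun_prop : Continuous fun p : ℝ × ℝ => (p.1, τ, p.2))).mul cP
    have iF : Integrable (fun p => duhamelIntegrand φ G p.1 τ p.2 * P p) ν :=
      integrable_strip (R := R) cF (fun t x hx => by simp [zP t x hx]) T
    have iK : Integrable (fun p => K p τ) ν := by
      rw [hKτ]
      exact iF.indicator (measurableSet_Ici.prod MeasurableSet.univ)
    rw [integral_prod _ iK]
    have hin : ∀ t, ∫ x, K (t, x) τ
        = (Ici τ).indicator (fun t => ∫ x, duhamelIntegrand φ G t τ x * P (t, x)) t := by
      intro t
      by_cases htt : τ ≤ t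
      · simp [hK, htt]
      · simp [hK, htt]
    simp only [hin]
    have hset : Ioc 0 T ∩ Ici τ = Icc τ T := by
      ext t
      simp only [mem_inter_iff, mem_Ioc, mem_Ici, mem_Icc]
      exact ⟨fun h => ⟨h.2, h.1.2⟩, fun h => ⟨⟨hτ.1.trans_le h.1, h.2⟩, h.1⟩⟩
    rw [setIntegral_indicator measurableSet_Ici, hset, integral_Icc_eq_integral_Ioc]
    exact integral_smoothEvolution_sub_mul_test (isBoundedC2_conv_slice φ hG hB τ) hh hτ.2 hR
  have i6 : Integrable (fun p => conv φ (G p.1) p.2 * h p.1 p.2) ν :=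
    integrable_strip (R := R) ((continuous_conv φ hG hB).mul c0)
      (fun t x hx => by simp [hh.eq_zero t x (Or.inr hx)]) T
  rw [e1, integral_integral_swap hKi, setIntegral_congr_fun measurableSet_Ioc e2,
    integral_const_mul, integral_prod _ i6]

/-- The free part contributes nothing because the test function vanishes at time zero. The Duhamel
part contributes `-I * I = 1` times the nonlinearity. -/
lemma solvesWeakly_of_mild (φ : 𝓢(ℝ, ℝ)) {f f' f'' : ℝ → ℂ} {M₀ M₂ T r : ℝ} (hT0 : 0 < T)
    (hT : T ≤ 1) (hf : IsBoundedC2 f f' f'' M₀ M₂) {u : ℝ → ℝ → ℂ}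
    (hu : Continuous fun p : ℝ × ℝ => u p.1 p.2) (hr : ∀ t x, ‖u t x‖ ≤ r)
    (hmild : ∀ t ∈ Icc 0 T, ∀ x,
      u t x = smoothEvolution f f'' t x - I * duhamel φ (cubicSource φ u) t x) :
    SolvesWeakly φ T u := by
  intro Ψ hΨ hc hsupp
  obtain ⟨R, hR, hh, hz⟩ := exists_testJet hΨ hc hsupp
  have hr0 : 0 ≤ r := (norm_nonneg _).trans (hr 0 0)
  have gc := continuous_cubicSource φ hu hr
  have gb := norm_cubicSource_le φ hr0 hu hr
  have hzT : ∀ t x, T ≤ t → Ψ (t, x) = 0 ∧ deriv (fun s => Ψ (s, x)) t = 0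
      ∧ iteratedDeriv 2 (fun y => Ψ (t, y)) x = 0 := fun t x h => by
    obtain ⟨h1, h2, -, h3⟩ := hh.eq_zero t x (Or.inl h)
    exact ⟨h1, h2, h3⟩
  set ν := (volume.restrict (Ioc 0 T)).prod (volume : Measure ℝ) with hν
  have c1 := hh.continuous_t
  have c2 := hh.continuous_xx
  set P : ℝ × ℝ → ℂ := fun p => -I * deriv (fun s => Ψ (s, p.2)) p.1
    + iteratedDeriv 2 (fun y => Ψ (p.1, y)) p.2 with hP
  have cP : Continuous P := by fun_prop
  have zP : ∀ t x, R ≤ |x| → P (t, x) = 0 := fun t x hx => by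
    obtain ⟨-, h1, -, h2⟩ := hh.eq_zero t x (Or.inr hx)
    simp [hP, h1, h2]
  have hνIoc : ∀ᵐ p ∂ν, p.1 ∈ Ioc 0 T :=
    (Measure.quasiMeasurePreserving_fst (μ := volume.restrict (Ioc 0 T)) (ν := volume)).ae
      (ae_restrict_mem measurableSet_Ioc)
  have iS : Integrable (fun p => smoothEvolution f f'' p.1 p.2 * P p) ν :=
    integrable_strip (R := R) (hf.continuous_smoothEvolution.mul cP)
      (fun t x hx => by simp [zP t x hx]) T
  have iD : Integrable (fun p => duhamel φ (cubicSource φ u) p.1 p.2 * P p) ν :=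
    integrable_strip (R := R) ((continuous_duhamel φ gc gb).mul cP)
      (fun t x hx => by simp [zP t x hx]) T
  have e1 : ∫ p, u p.1 p.2 * P p ∂ν
      = (∫ p, smoothEvolution f f'' p.1 p.2 * P p ∂ν)
        - I * ∫ p, duhamel φ (cubicSource φ u) p.1 p.2 * P p ∂ν := by
    rw [← integral_const_mul, ← integral_sub iS (iD.const_mul I)]
    refine integral_congr_ae ?_
    filter_upwards [hνIoc] with p hp
    rw [hmild p.1 ⟨hp.1.le, hp.2⟩]
    ring
  have e2 : ∫ p, smoothEvolution f f'' p.1 p.2 * P p ∂ν = 0 := by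
    rw [integral_prod _ iS]
    refine (integral_smoothEvolution_mul_test hf hh hT0.le hR).trans ?_
    simp [(hz 0 _ le_rfl).1]
  have e3 := integral_duhamel_mul_test φ gc gb hT hh hR
  rw [integral_eq_integral_strip (T := T), integral_eq_integral_strip (T := T)]
  · refine e1.trans ?_
    rw [e2, e3, ← mul_assoc, I_mul_I, zero_sub, neg_one_mul, neg_neg]
    rfl
  · intro t x h; simp [(hz t x h).1]
  · intro t x h; simp [(hzT t x h).1]
  · intro t x h; simp [hz t x h]
  · intro t x h; simp [hzT t x h]

/-- Every slice of the nonlinearity is a convolution with `φ`, hence bounded `C²` data, so the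
improper integrals converge and `freeEvolution` equals `smoothEvolution`. -/
lemma satisfiesDuhamel_of_mild (φ : 𝓢(ℝ, ℝ)) {f f' f'' : ℝ → ℂ} {M₀ M₂ T r : ℝ}
    (hf : IsBoundedC2 f f' f'' M₀ M₂) {u : ℝ → ℝ → ℂ}
    (hu : Continuous fun p : ℝ × ℝ => u p.1 p.2) (hr : ∀ t x, ‖u t x‖ ≤ r)
    (hmild : ∀ t ∈ Icc 0 T, ∀ x,
      u t x = smoothEvolution f f'' t x - I * duhamel φ (cubicSource φ u) t x) :
    SatisfiesDuhamel φ f T u := by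
  have hr0 : 0 ≤ r := (norm_nonneg _).trans (hr 0 0)
  have gc := continuous_cubicSource φ hu hr
  have gb := norm_cubicSource_le φ hr0 hu hr
  have hn : ∀ τ, IsBoundedC2 (nonlinearity φ (u τ)) _ _ _ _ := isBoundedC2_conv_slice φ gc gb
  have heq : ∀ t x, 0 ≤ t → ∀ τ ∈ uIcc 0 t, freeEvolution (t - τ) (nonlinearity φ (u τ)) x
      = duhamelIntegrand φ (cubicSource φ u) t τ x := fun t x ht τ hτ => by
    rw [uIcc_of_le ht] at hτ
    exact freeEvolution_eq (hn τ) (sub_nonneg.2 hτ.2) x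
  refine ⟨fun t ht x => evolutionConverges hf ht.1 x,
    fun τ _ s hs x => evolutionConverges (hn τ) hs.1 x, fun t ht x => ?_, fun t ht x => ?_⟩
  · refine (intervalIntegrable_duhamelIntegrand φ gc gb t x 0 t).congr fun τ hτ => ?_
    exact (heq t x ht.1 τ (uIoc_subset_uIcc hτ)).symm
  · rw [hmild t ht x, freeEvolution_eq hf ht.1, intervalIntegral.integral_congr (heq t x ht.1)]
    rfl

end RegularizedNLS

end

/-! ### Assembly of the theorem -/

theorem theorem1 (φ : 𝓢(ℝ, ℝ)) (hφ : ∀ x : ℝ, φ (-x) = φ x) (M₀ M₂ : ℝ) :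
    ∃ T : ℝ, 0 < T ∧
      ∀ u₀ : ℝ → ℂ, ContDiff ℝ 2 u₀ → (∀ x : ℝ, ‖u₀ x‖ ≤ M₀) →
        (∀ x : ℝ, ‖iteratedDeriv 2 u₀ x‖ ≤ M₂) →
        ∃ u : ℝ → ℝ → ℂ, RegularizedNLS.IsSolution φ u₀ T u ∧
          (∃ C : ℝ, ∀ t ∈ Icc 0 T, ∀ x : ℝ, ‖u t x‖ ≤ C) ∧
          UniformContinuousOn (fun p : ℝ × ℝ => u p.1 p.2) (Icc 0 T ×ˢ univ) := by
  obtain ⟨T, hT0, hT1, hT⟩ := RegularizedNLS.exists_mild_solution φ M₀ M₂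
  refine ⟨T, hT0, fun u₀ hu₀ h0 h2 => ?_⟩
  have hf : RegularizedNLS.IsBoundedC2 u₀ (deriv u₀) (iteratedDeriv 2 u₀) M₀ M₂ := by
    refine ⟨fun x => (hu₀.differentiable (by simp) x).hasDerivAt, fun x => ?_,
      hu₀.continuous_iteratedDeriv 2 le_rfl, h0, h2⟩
    rw [iteratedDeriv_succ, iteratedDeriv_one]
    have := hu₀.differentiable_iteratedDeriv 1 (by norm_num)
    rw [iteratedDeriv_one] at this
    exact (this x).hasDerivAt
  obtain ⟨u, hu, ⟨r, hr⟩, hmild⟩ := hT hf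
  have hr0 : 0 ≤ r := (norm_nonneg _).trans (hr 0 0)
  refine ⟨u, ⟨hu.continuousOn, fun x => ?_,
    RegularizedNLS.solvesWeakly_of_mild φ hT0 hT1 hf hu hr hmild,
    RegularizedNLS.satisfiesDuhamel_of_mild φ hf hu hr hmild⟩, ⟨r, fun t _ => hr t⟩, ?_⟩
  · rw [hmild 0 ⟨le_rfl, hT0.le⟩ x, RegularizedNLS.smoothEvolution_zero, RegularizedNLS.duhamel,
      intervalIntegral.integral_same, mul_zero, sub_zero]
  · have hD := RegularizedNLS.uniformContinuousOn_duhamel φ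
      (RegularizedNLS.continuous_cubicSource φ hu hr)
      (RegularizedNLS.norm_cubicSource_le φ hr0 hu hr) hT1
    have hS := RegularizedNLS.uniformContinuousOn_smoothEvolution hf T
    have hI : UniformContinuous fun w : ℂ × ℂ => w.1 - I * w.2 :=
      uniformContinuous_fst.sub (uniformContinuous_snd.const_mul' I)
    rw [uniformContinuousOn_iff_restrict] at hS hD
    have hSD : UniformContinuousOn (fun p : ℝ × ℝ =>
        RegularizedNLS.smoothEvolution u₀ (iteratedDeriv 2 u₀) p.1 p.2
          - I * RegularizedNLS.duhamel φ (RegularizedNLS.cubicSource φ u) p.1 p.2)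
        (Icc 0 T ×ˢ univ) :=
      uniformContinuousOn_iff_restrict.2 (hI.comp (hS.prodMk hD))
    exact hSD.congr fun p hp => (hmild p.1 hp.1 p.2).symm
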